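/- Let $\Sigma$ be a closed (compact, without boundary) smooth manifold of dimension $n-1$, let $t_0>0$, and let $\{g_t\}_{t\in[0,t_0]}$ be a smooth family of Riemannian metrics on $\Sigma$. For a smooth positive function $f$ on $\Sigma\times[0,t_0]$ consider the Riemannian metric $g_f := f^2\,dt^2+g_t$ on $\Sigma\times[0,t_0]$. Let $h_f$ be the second fundamental form of the leaves $\Sigma\times\{t\}$ in $g_f$ with respect to the unit normal $\nu_f=f^{-1}\partial_t$, that is $h_f(X,Y)=g_f(\nabla_X\nu_f,Y)$, and let $H_f=\operatorname{tr}_{g_t}h_f$ be their mean curvature. Write $R(\cdot)$ and $\mathrm{Ric}(\cdot)$ for the scalar and the Ricci curvature of a metric, $2K:=R(g_t)$ for the scalar curvature of $g_t$, and $d\sigma_t$ for the Riemannian volume measure of $g_t$ on $\Sigma\times\{t\}$. Assume that $K$ and the mean curvature $H_1$ of the leaves with respect to $g_1=dt^2+g_t$ are positive everywhere on $\Sigma\times[0,t_0]$. Let $u$ and $\eta$ be smooth positive functions on $\Sigma\times[0,t_0]$ such that $$R(g_u)=0\qquad\text{and}\qquad \mathrm{Ric}(g_\eta)=0 .$$ Then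 the function $$t\mapsto\int_{\Sigma\times\{t\}}(H_\eta-H_u)\,d\sigma_t$$ is differentiable on $[0,t_0]$ (one-sidedly at the endpoints), with $$\frac{d}{dt}\int_{\Sigma\times\{t\}}(H_\eta-H_u)\,d\sigma_t=-\int_{\Sigma\times\{t\}}K\,\frac{(\eta-u)^2}{u}\,d\sigma_t ,$$ and it is monotone non-increasing on $[0,t_0]$. (For every $t$ both integrands are integrable.) -/

import Mathlib

open MeasureTheory Set
open scoped Manifold ContDiff

noncomputable section

namespace CoordGeom

/-! ### Riemannian geometry in coordinates

`V` is the coordinate space, `b : ι → V` the coordinate frame, `S ⊆ V` the coordinate domain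
and `G : V → Matrix ι ι ℝ` the matrix of metric components. Derivatives are taken within `S`,
so that they are one-sided at boundary points of `S`. -/

/-- The partial derivative of `F` in the direction `v`, within the domain `S`. -/
def pderiv {V : Type*} [NormedAddCommGroup V] [NormedSpace ℝ V]
    (S : Set V) (v : V) (F : V → ℝ) (x : V) : ℝ :=
  fderivWithin ℝ F S x v

/-- The Christoffel symbol `Γ^k_{ij}` of the Levi-Civita connection. -/
def christoffel {V : Type*} [NormedAddCommGroup V] [NormedSpace ℝ V]
    {ι : Type*} [Fintype ι] [DecidableEq ι]
    (S : Set V) (b : ι → V) (G : V → Matrix ι ι ℝ) (k i j : ι) (x : V) : ℝ :=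
  (1 / 2) * ∑ l, (G x)⁻¹ k l *
    (pderiv S (b i) (fun z ↦ G z j l) x + pderiv S (b j) (fun z ↦ G z i l) x
      - pderiv S (b l) (fun z ↦ G z i j) x)

/-- The `a`-th component of `∇_{∂_i} X`, for the vector field with components `X a`. -/
def covDeriv {V : Type*} [NormedAddCommGroup V] [NormedSpace ℝ V]
    {ι : Type*} [Fintype ι] [DecidableEq ι]
    (S : Set V) (b : ι → V) (G : V → Matrix ι ι ℝ) (i : ι) (X : ι → V → ℝ) (a : ι) (x : V) : ℝ :=
  pderiv S (b i) (X a) x + ∑ c, christoffel S b G a i c x * X c x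

/-- The component `R^l_{kij}` of the curvature tensor: the `∂_l`-component of
`R(∂_i, ∂_j) ∂_k = ∇_{∂_i} ∇_{∂_j} ∂_k - ∇_{∂_j} ∇_{∂_i} ∂_k`. -/
def riemann {V : Type*} [NormedAddCommGroup V] [NormedSpace ℝ V]
    {ι : Type*} [Fintype ι] [DecidableEq ι]
    (S : Set V) (b : ι → V) (G : V → Matrix ι ι ℝ) (l k i j : ι) (x : V) : ℝ :=
  pderiv S (b i) (christoffel S b G l j k) x - pderiv S (b j) (christoffel S b G l i k) x
    + ∑ p, (christoffel S b G l i p x * christoffel S b G p j k x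
      - christoffel S b G l j p x * christoffel S b G p i k x)

/-- The component `Ric_{jk}`, the trace of `X ↦ R(X, ∂_j) ∂_k`. -/
def ricci {V : Type*} [NormedAddCommGroup V] [NormedSpace ℝ V]
    {ι : Type*} [Fintype ι] [DecidableEq ι]
    (S : Set V) (b : ι → V) (G : V → Matrix ι ι ℝ) (j k : ι) (x : V) : ℝ :=
  ∑ i, riemann S b G i k i j x

/-- The scalar curvature, the metric trace of the Ricci tensor. -/
def scalarCurv {V : Type*} [NormedAddCommGroup V] [NormedSpace ℝ V]
    {ι : Type*} [Fintype ι] [DecidableEq ι]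
    (S : Set V) (b : ι → V) (G : V → Matrix ι ι ℝ) (x : V) : ℝ :=
  ∑ j, ∑ k, (G x)⁻¹ j k * ricci S b G j k x

end CoordGeom

namespace Foliation

open CoordGeom

/-- The model space of an `m`-dimensional manifold. -/
abbrev Model (m : ℕ) : Type := EuclideanSpace ℝ (Fin m)

/-- Smooth Riemannian metrics on the `m`-dimensional manifold `M`. -/
abbrev SmoothMetric (m : ℕ) (M : Type*) [TopologicalSpace M] [ChartedSpace (Model m) M]
    [IsManifold 𝓘(ℝ, Model m) ∞ M] :=
  Bundle.ContMDiffRiemannianMetric 𝓘(ℝ, Model m) ∞ (Model m)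
    (fun x : M ↦ TangentSpace 𝓘(ℝ, Model m) x)

section Coordinates

variable {m : ℕ} {M : Type*} [TopologicalSpace M] [ChartedSpace (Model m) M]
  [IsManifold 𝓘(ℝ, Model m) ∞ M]

/-- The standard frame of the model space. -/
def frame (m : ℕ) (i : Fin m) : Model m := EuclideanSpace.single i 1

/-- The coordinate vector field `∂_i` of the chart `e`, at the point with coordinates `y`. -/
def coordVec (e : OpenPartialHomeomorph M (Model m)) (i : Fin m) (y : Model m) :
    TangentSpace 𝓘(ℝ, Model m) (e.symm y) :=
  mfderiv 𝓘(ℝ, Model m) 𝓘(ℝ, Model m) e.symm y (frame m i)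

/-- The matrix `g(∂_i, ∂_j)` of the metric `g` in the chart `e`. -/
def metricMatrix (g : SmoothMetric m M) (e : OpenPartialHomeomorph M (Model m)) (y : Model m) :
    Matrix (Fin m) (Fin m) ℝ :=
  Matrix.of fun i j ↦ g.inner (e.symm y) (coordVec e i y) (coordVec e j y)

/-- The scalar curvature of `g` at `p`, computed in the preferred chart at `p`. -/
def scalarCurvature (g : SmoothMetric m M) (p : M) : ℝ :=
  scalarCurv (chartAt (Model m) p).target (frame m) (metricMatrix g (chartAt (Model m) p))
    (chartAt (Model m) p p)

/-- The measure on the domain of the chart `e` with density `√(det g_{ij})` in coordinates. -/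
def chartVolume [MeasurableSpace M] (g : SmoothMetric m M)
    (e : OpenPartialHomeomorph M (Model m)) : Measure M :=
  Measure.map e.symm (((volume : Measure (Model m)).restrict e.target).withDensity
    fun y ↦ ENNReal.ofReal (Real.sqrt (metricMatrix g e y).det))

/-- The Riemannian volume measure of `g`. The measures `chartVolume g e` agree on overlaps of
charts, and their supremum is the measure on `M` that restricts to each of them. -/
def volumeMeasure [MeasurableSpace M] (g : SmoothMetric m M) : Measure M :=
  ⨆ e ∈ atlas (Model m) M, chartVolume g e

/-- The family `g t`, `t ∈ [0, t₀]`, is smooth: in each chart the components of `g t` are smooth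
in the coordinates and in `t` jointly. (The values of `g` outside `[0, t₀]` play no role.) -/
def SmoothFamily (t₀ : ℝ) (g : ℝ → SmoothMetric m M) : Prop :=
  ∀ e ∈ atlas (Model m) M, ∀ i j : Fin m,
    ContDiffOn ℝ ∞ (fun z : Model m × ℝ ↦ metricMatrix (g z.2) e z.1 i j)
      (e.target ×ˢ Icc 0 t₀)

/-- `f` is a smooth function on `M × [0, t₀]`. -/
def SmoothOnSlab (t₀ : ℝ) (f : M × ℝ → ℝ) : Prop :=
  ContMDiffOn (𝓘(ℝ, Model m).prod 𝓘(ℝ, ℝ)) 𝓘(ℝ, ℝ) ∞ f (univ ×ˢ Icc 0 t₀)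

/-- The coordinate domain of `M × [0, t₀]` belonging to the chart `e` of `M`. -/
def slab (t₀ : ℝ) (e : OpenPartialHomeomorph M (Model m)) : Set (Model m × ℝ) :=
  e.target ×ˢ Icc 0 t₀

/-- The coordinate frame on `M × [0, t₀]`: `inl i` is `∂_i`, and `inr ()` is `∂_t`. -/
def slabFrame (m : ℕ) : Fin m ⊕ Unit → Model m × ℝ :=
  Sum.elim (fun i ↦ (frame m i, 0)) (fun _ ↦ (0, 1))

/-- The components of `g_f = f² dt² + g_t` in the coordinates `(y, t)`. -/
def slabMatrix (g : ℝ → SmoothMetric m M) (f : M × ℝ → ℝ)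
    (e : OpenPartialHomeomorph M (Model m)) (z : Model m × ℝ) :
    Matrix (Fin m ⊕ Unit) (Fin m ⊕ Unit) ℝ :=
  Matrix.fromBlocks (metricMatrix (g z.2) e z.1) 0 0
    (Matrix.of fun _ _ ↦ f (e.symm z.1, z.2) ^ 2)

/-- The scalar curvature of `g_f` vanishes identically on `M × [0, t₀]`. -/
def ScalarFlat (t₀ : ℝ) (g : ℝ → SmoothMetric m M) (f : M × ℝ → ℝ) : Prop :=
  ∀ e ∈ atlas (Model m) M, ∀ z ∈ slab t₀ e,
    scalarCurv (slab t₀ e) (slabFrame m) (slabMatrix g f e) z = 0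

/-- The Ricci tensor of `g_f` vanishes identically on `M × [0, t₀]`. -/
def RicciFlat (t₀ : ℝ) (g : ℝ → SmoothMetric m M) (f : M × ℝ → ℝ) : Prop :=
  ∀ e ∈ atlas (Model m) M, ∀ z ∈ slab t₀ e, ∀ a c,
    ricci (slab t₀ e) (slabFrame m) (slabMatrix g f e) a c z = 0

/-- The components of the unit normal `ν = f⁻¹ ∂_t` of the leaves `M × {t}` in `g_f`. -/
def unitNormal (f : M × ℝ → ℝ) (e : OpenPartialHomeomorph M (Model m)) :
    Fin m ⊕ Unit → Model m × ℝ → ℝ :=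
  Sum.elim (fun _ _ ↦ 0) (fun _ z ↦ (f (e.symm z.1, z.2))⁻¹)

/-- The second fundamental form of the leaves with respect to `g_f`,
`h_f(∂_i, ∂_j) = g_f(∇_{∂_i} ν, ∂_j)`, where `∇` is the Levi-Civita connection of `g_f`. -/
def secondFundamentalForm (t₀ : ℝ) (g : ℝ → SmoothMetric m M) (f : M × ℝ → ℝ)
    (e : OpenPartialHomeomorph M (Model m)) (i j : Fin m) (z : Model m × ℝ) : ℝ :=
  ∑ a, covDeriv (slab t₀ e) (slabFrame m) (slabMatrix g f e) (Sum.inl i) (unitNormal f e) a z *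
    slabMatrix g f e z a (Sum.inl j)

/-- The mean curvature `H_f` of the leaf `M × {t}` with respect to `g_f` at the point `p`: the
trace, with respect to `g_t`, of the second fundamental form. -/
def meanCurvature (t₀ : ℝ) (g : ℝ → SmoothMetric m M) (f : M × ℝ → ℝ) (t : ℝ) (p : M) : ℝ :=
  ∑ i, ∑ j, (metricMatrix (g t) (chartAt (Model m) p) (chartAt (Model m) p p))⁻¹ i j *
    secondFundamentalForm t₀ g f (chartAt (Model m) p) i j (chartAt (Model m) p p, t)

end Coordinates

end Foliation

end

/-! Write `H` and `|h|²` for the mean curvature and the squared norm of the second fundamental form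
of the leaves in `dt² + g_t`. A lapse `f` only rescales the normal, so `H_f = H / f`. Two identities
for `f² dt² + g_t` carry the proof. One is the evolution equation `ricci_warped_tt`, `Ric(∂_t, ∂_t)
= -f Δf - ∂_t H + H ∂_t f / f - |h|²`. The other is the traced Gauss equation `scalarCurv_warped`,
`R(g_f) = 2K + (|h|² - H²) / f² + 2 Ric(∂_t, ∂_t) / f²`.

For the Ricci flat metric the Gauss equation reads `H² - |h|² = 2 K η²` (`RicciFlat.leafScal_eq`).
For a scalar flat `g_f` the two identities combine to `∂_t (H / f) + H² / f = f K + (H² - |h|²) / (2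
f) - Δf` (`ScalarFlat.pderiv_meanCurvature`). Since `∂_t dσ = H dσ` and `∫ Δf dσ = 0`, it follows
that `d/dt ∫ H_f dσ = ∫ K (f + η² / f) dσ`. Ricci flat implies scalar flat, so this applies to both
`f = η` and `f = u`. The difference of the two rates has integrand `K (2η - u - η² / u) = -K (η -
u)² / u`, whose sign is that of `-K`.

Curvature is computed in coordinates. To reach `M`, the local expressions that are integrated are
shown to agree on chart overlaps (`IsInvariant`), the volume measure is identified in every chart
(`volumeMeasure_restrict`), and integrals are split by a finite partition of unity. The vanishing of
`∫ Δf dσ` (`sum_integral_laplacian`) comes from integration by parts in each chart, followed by `∑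
dρ_i = d1 = 0`. -/

noncomputable section

namespace CoordGeom

/-! ### Calculus of partial derivatives and of matrix-valued functions on a domain. -/

section Calculus

variable {V : Type*} [NormedAddCommGroup V] [NormedSpace ℝ V] {S : Set V} {v : V}
  {F F' : V → ℝ} {x : V} {ι κ μ : Type*} 

theorem pderiv_congr (h : EqOn F F' S) (hx : x ∈ S) : pderiv S v F x = pderiv S v F' x := by
  unfold pderiv
  rw [fderivWithin_congr h (h hx)]

theorem pderiv_const (c : ℝ) : pderiv S v (fun _ ↦ c) x = 0 := by
  simp [pderiv]

theorem pderiv_neg (hS : UniqueDiffOn ℝ S) (hx : x ∈ S) :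
    pderiv S v (fun z ↦ -F z) x = -pderiv S v F x := by
  unfold pderiv
  rw [fderivWithin_fun_neg (hS x hx)]
  rfl

theorem pderiv_mul (hS : UniqueDiffOn ℝ S) (hx : x ∈ S) (hF : DifferentiableOn ℝ F S)
    (hF' : DifferentiableOn ℝ F' S) :
    pderiv S v (fun z ↦ F z * F' z) x = pderiv S v F x * F' x + F x * pderiv S v F' x := by
  unfold pderiv
  rw [fderivWithin_fun_mul (hS x hx) (hF x hx) (hF' x hx)]
  simp only [add_apply, FunLike.coe_smul, Pi.smul_apply, smul_eq_mul]
  ring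

theorem pderiv_const_mul (hS : UniqueDiffOn ℝ S) (hx : x ∈ S) (hF : DifferentiableOn ℝ F S)
    (c : ℝ) : pderiv S v (fun z ↦ c * F z) x = c * pderiv S v F x := by
  rw [pderiv_mul hS hx (differentiableOn_const c) hF, pderiv_const]
  ring

theorem pderiv_sum (hS : UniqueDiffOn ℝ S) (hx : x ∈ S) {α : Type*} {s : Finset α}
    {f : α → V → ℝ} (hf : ∀ i ∈ s, DifferentiableOn ℝ (f i) S) :
    pderiv S v (fun z ↦ ∑ i ∈ s, f i z) x = ∑ i ∈ s, pderiv S v (f i) x := by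
  unfold pderiv
  rw [fderivWithin_fun_sum (hS x hx) (fun i hi ↦ hf i hi x hx)]
  simp

theorem pderiv_inv (hS : UniqueDiffOn ℝ S) (hx : x ∈ S) (hF : DifferentiableOn ℝ F S)
    (h0 : ∀ z ∈ S, F z ≠ 0) :
    pderiv S v (fun z ↦ (F z)⁻¹) x = -pderiv S v F x / F x ^ 2 := by
  have h1 : pderiv S v (fun z ↦ F z * (F z)⁻¹) x = 0 := by
    rw [pderiv_congr (F' := fun _ ↦ 1) (fun z hz ↦ mul_inv_cancel₀ (h0 z hz)) hx, pderiv_const]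
  rw [pderiv_mul (F' := fun z ↦ (F z)⁻¹) hS hx hF (hF.inv h0)] at h1
  have := h0 x hx
  field_simp at h1 ⊢
  linarith

theorem _root_.ContDiffOn.pderiv (hF : ContDiffOn ℝ ∞ F S) (hS : UniqueDiffOn ℝ S) (v : V) :
    ContDiffOn ℝ ∞ (CoordGeom.pderiv S v F) S :=
  ((contDiffOn_infty_iff_fderivWithin hS).1 hF).2.clm_apply contDiffOn_const

theorem _root_.ContDiffOn.differentiableOn_infty (hF : ContDiffOn ℝ ∞ F S) :
    DifferentiableOn ℝ F S :=
  hF.differentiableOn (by simp)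

/-- The matrix-valued function `A` has smooth entries on `S`. -/
def SmoothMatrixOn (S : Set V) (A : V → Matrix ι κ ℝ) : Prop :=
  ∀ i j, ContDiffOn ℝ ∞ (fun z ↦ A z i j) S

/-- The entrywise partial derivative of a matrix-valued function. -/
def matDeriv (S : Set V) (v : V) (A : V → Matrix ι κ ℝ) (x : V) : Matrix ι κ ℝ :=
  Matrix.of fun i j ↦ pderiv S v (fun z ↦ A z i j) x

theorem matDeriv_apply (A : V → Matrix ι κ ℝ) (i : ι) (j : κ) :
    matDeriv S v A x i j = pderiv S v (fun z ↦ A z i j) x := rfl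

theorem SmoothMatrixOn.matDeriv {A : V → Matrix ι κ ℝ} (hA : SmoothMatrixOn S A)
    (hS : UniqueDiffOn ℝ S) (v : V) : SmoothMatrixOn S (matDeriv S v A) :=
  fun i j ↦ (hA i j).pderiv hS v

theorem SmoothMatrixOn.mul [Fintype κ] {A : V → Matrix ι κ ℝ} {B : V → Matrix κ μ ℝ}
    (hA : SmoothMatrixOn S A) (hB : SmoothMatrixOn S B) : SmoothMatrixOn S (fun z ↦ A z * B z) :=
  fun i j ↦ ContDiffOn.sum fun k _ ↦ (hA i k).mul (hB k j)

theorem SmoothMatrixOn.trace [Fintype ι] {A : V → Matrix ι ι ℝ} (hA : SmoothMatrixOn S A) :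
    ContDiffOn ℝ ∞ (fun z ↦ (A z).trace) S :=
  ContDiffOn.sum fun k _ ↦ hA k k

theorem SmoothMatrixOn.det [Fintype ι] [DecidableEq ι] {A : V → Matrix ι ι ℝ} (hA : SmoothMatrixOn S A) :
    ContDiffOn ℝ ∞ (fun z ↦ (A z).det) S := by
  simp only [Matrix.det_apply']
  exact ContDiffOn.sum fun σ _ ↦ contDiffOn_const.mul (contDiffOn_prod fun i _ ↦ hA _ _)

theorem SmoothMatrixOn.inv [Fintype ι] [DecidableEq ι] {A : V → Matrix ι ι ℝ} (hA : SmoothMatrixOn S A)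
    (hdet : ∀ z ∈ S, (A z).det ≠ 0) : SmoothMatrixOn S (fun z ↦ (A z)⁻¹) := by
  intro i j
  -- Cramer's rule: an entry of the inverse is a quotient of determinants, hence a rational
  -- expression in the entries.
  have h : ∀ z, (A z)⁻¹ i j = ((A z).det)⁻¹ * ((A z).updateRow j (Pi.single i 1)).det := by
    intro z
    rw [Matrix.inv_def, Matrix.smul_apply, Matrix.adjugate_apply, Ring.inverse_eq_inv', smul_eq_mul]
  simp only [h]
  refine (hA.det.inv hdet).mul (SmoothMatrixOn.det fun k l ↦ ?_)
  by_cases hk : k = j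
  · subst hk
    simpa using contDiffOn_const
  · simpa [Matrix.updateRow_ne hk] using hA k l

theorem matDeriv_mul [Fintype κ] {A : V → Matrix ι κ ℝ} {B : V → Matrix κ μ ℝ}
    (hA : SmoothMatrixOn S A) (hB : SmoothMatrixOn S B) (hS : UniqueDiffOn ℝ S) (hx : x ∈ S) :
    matDeriv S v (fun z ↦ A z * B z) x = matDeriv S v A x * B x + A x * matDeriv S v B x := by
  ext i j
  simp only [matDeriv_apply, Matrix.mul_apply, Matrix.add_apply]
  rw [pderiv_sum hS hx fun k _ ↦ ((hA i k).mul (hB k j)).differentiableOn_infty,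
    ← Finset.sum_add_distrib]
  exact Finset.sum_congr rfl fun k _ ↦ pderiv_mul hS hx (hA i k).differentiableOn_infty
    (hB k j).differentiableOn_infty

theorem pderiv_trace [Fintype ι] {A : V → Matrix ι ι ℝ} (hA : SmoothMatrixOn S A) (hS : UniqueDiffOn ℝ S)
    (hx : x ∈ S) : pderiv S v (fun z ↦ (A z).trace) x = (matDeriv S v A x).trace := by
  simp only [Matrix.trace, Matrix.diag]
  exact pderiv_sum hS hx fun k _ ↦ (hA k k).differentiableOn_infty

/-- Differentiate `A⁻¹ A = 1` and solve for the derivative of the first factor. -/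
theorem matDeriv_inv [Fintype ι] [DecidableEq ι] {A : V → Matrix ι ι ℝ} (hA : SmoothMatrixOn S A)
    (hdet : ∀ z ∈ S, (A z).det ≠ 0) (hS : UniqueDiffOn ℝ S) (hx : x ∈ S) :
    matDeriv S v (fun z ↦ (A z)⁻¹) x = -((A x)⁻¹ * matDeriv S v A x * (A x)⁻¹) := by
  have h1 : matDeriv S v (fun z ↦ (A z)⁻¹ * A z) x = 0 := by
    ext i j
    rw [matDeriv_apply, pderiv_congr (F' := fun _ ↦ (1 : Matrix ι ι ℝ) i j) _ hx, pderiv_const]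
    · rfl
    · intro z hz
      simp only [Matrix.nonsing_inv_mul _ (isUnit_iff_ne_zero.2 (hdet z hz))]
  rw [matDeriv_mul (hA.inv hdet) hA hS hx] at h1
  have h2 := congrArg (· * (A x)⁻¹) (eq_neg_of_add_eq_zero_left h1)
  simpa [Matrix.mul_assoc, Matrix.mul_nonsing_inv _ (isUnit_iff_ne_zero.2 (hdet x hx))] using h2

theorem pderiv_prod (hS : UniqueDiffOn ℝ S) (hx : x ∈ S) [DecidableEq ι] {s : Finset ι}
    {f : ι → V → ℝ} (hf : ∀ i ∈ s, DifferentiableOn ℝ (f i) S) :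
    pderiv S v (fun z ↦ ∏ i ∈ s, f i z) x
      = ∑ i ∈ s, (∏ j ∈ s.erase i, f j x) * pderiv S v (f i) x := by
  unfold pderiv
  rw [fderivWithin_finsetProd (hS x hx) fun i hi ↦ hf i hi x hx]
  simp

/-- Jacobi's formula. -/
theorem pderiv_det [Fintype ι] [DecidableEq ι] {A : V → Matrix ι ι ℝ} (hA : SmoothMatrixOn S A)
    (hdet : ∀ z ∈ S, (A z).det ≠ 0) (hS : UniqueDiffOn ℝ S) (hx : x ∈ S) :
    pderiv S v (fun z ↦ (A z).det) x = (A x).det * ((A x)⁻¹ * matDeriv S v A x).trace := by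
  have h1 : (A x).det * ((A x)⁻¹ * matDeriv S v A x).trace
      = ((A x).adjugate * matDeriv S v A x).trace := by
    rw [Matrix.inv_def, Ring.inverse_eq_inv', Matrix.smul_mul, Matrix.trace_smul, smul_eq_mul,
      mul_inv_cancel_left₀ (hdet x hx)]
  -- By Cramer's rule a diagonal entry of `adj(A) A'` is the determinant of `A` with one column
  -- replaced by its derivative. The product rule applied to the Leibniz expansion produces the sum
  -- of exactly these determinants.
  have h2 : ∀ i, ((A x).adjugate * matDeriv S v A x) i i
      = ((A x).updateCol i fun k ↦ matDeriv S v A x k i).det := by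
    intro i
    rw [← Matrix.cramer_apply, Matrix.cramer_eq_adjugate_mulVec]
    rfl
  have hd : ∀ i j, DifferentiableOn ℝ (fun z ↦ A z i j) S :=
    fun i j ↦ (hA i j).differentiableOn_infty
  rw [h1, Matrix.trace]
  simp only [Matrix.diag, h2, Matrix.det_apply']
  rw [pderiv_sum hS hx, Finset.sum_comm]
  · refine Finset.sum_congr rfl fun σ _ ↦ ?_
    rw [pderiv_const_mul hS hx (contDiffOn_prod fun i _ ↦ hA _ _).differentiableOn_infty,
      pderiv_prod hS hx fun i _ ↦ hd _ _, Finset.mul_sum]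
    refine Finset.sum_congr rfl fun i _ ↦ ?_
    rw [← Finset.prod_erase_mul _ _ (Finset.mem_univ i), Matrix.updateCol_self, matDeriv_apply]
    congr 2
    exact Finset.prod_congr rfl fun j hj ↦ by rw [Matrix.updateCol_ne (Finset.ne_of_mem_erase hj)]
  · exact fun σ _ ↦ (differentiableOn_const _).mul
      (contDiffOn_prod fun i _ ↦ hA _ _).differentiableOn_infty

end Calculus

/-! ### Metrics `G + φ² dt²`: leaf quantities and Christoffel symbols. -/

section Warped

variable {V : Type*} [NormedAddCommGroup V] [NormedSpace ℝ V] {S : Set V}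
  {ι : Type*} [Fintype ι] [DecidableEq ι] {z : V}

/-- The matrix `G` is smooth, symmetric and of positive determinant on `S`. -/
structure IsMetricOn (S : Set V) (G : V → Matrix ι ι ℝ) : Prop where
  smooth : SmoothMatrixOn S G
  symm : ∀ z ∈ S, ∀ i j, G z i j = G z j i
  det_pos : ∀ z ∈ S, 0 < (G z).det

/-- The block matrix of the metric `G + φ² dt²`. -/
def warped (G : V → Matrix ι ι ℝ) (φ : V → ℝ) (z : V) : Matrix (ι ⊕ Unit) (ι ⊕ Unit) ℝ :=
  Matrix.fromBlocks (G z) 0 0 (Matrix.of fun _ _ ↦ φ z ^ 2)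

/-- The endomorphism `G⁻¹ ∂_v G`, twice the shape operator for the lapse function `1`. -/
def shape (S : Set V) (v : V) (G : V → Matrix ι ι ℝ) (z : V) : Matrix ι ι ℝ :=
  (G z)⁻¹ * matDeriv S v G z

/-- The mean curvature of the leaves for the lapse function `1`. -/
def leafH (S : Set V) (v : V) (G : V → Matrix ι ι ℝ) (z : V) : ℝ :=
  1 / 2 * (shape S v G z).trace

/-- The squared norm of the second fundamental form of the leaves for the lapse function `1`. -/
def leafSq (S : Set V) (v : V) (G : V → Matrix ι ι ℝ) (z : V) : ℝ :=
  1 / 4 * (shape S v G z * shape S v G z).trace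

/-- The components of the gradient of `φ`. -/
def grad (S : Set V) (b : ι → V) (G : V → Matrix ι ι ℝ) (φ : V → ℝ) (i : ι) (z : V) : ℝ :=
  ∑ l, (G z)⁻¹ i l * pderiv S (b l) φ z

/-- The Laplacian of `φ`, as the divergence of its gradient. -/
def laplacian (S : Set V) (b : ι → V) (G : V → Matrix ι ι ℝ) (φ : V → ℝ) (z : V) : ℝ :=
  ∑ i, (pderiv S (b i) (grad S b G φ i) z + ∑ k, christoffel S b G i i k z * grad S b G φ k z)

variable {G : V → Matrix ι ι ℝ} {φ : V → ℝ}

theorem IsMetricOn.det_ne (hG : IsMetricOn S G) : ∀ z ∈ S, (G z).det ≠ 0 :=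
  fun z hz ↦ (hG.det_pos z hz).ne'

theorem IsMetricOn.inv (hG : IsMetricOn S G) : SmoothMatrixOn S (fun z ↦ (G z)⁻¹) :=
  hG.smooth.inv hG.det_ne

theorem IsMetricOn.transpose (hG : IsMetricOn S G) (hz : z ∈ S) : (G z).transpose = G z := by
  ext i j
  exact hG.symm z hz j i

theorem IsMetricOn.inv_symm (hG : IsMetricOn S G) (hz : z ∈ S) (i j : ι) :
    (G z)⁻¹ i j = (G z)⁻¹ j i := by
  conv_lhs => rw [← hG.transpose hz, ← Matrix.transpose_nonsing_inv]
  rfl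

theorem IsMetricOn.matDeriv_symm (hG : IsMetricOn S G) (hz : z ∈ S) (v : V) (i j : ι) :
    pderiv S v (fun z ↦ G z i j) z = pderiv S v (fun z ↦ G z j i) z :=
  pderiv_congr (fun w hw ↦ hG.symm w hw i j) hz

theorem christoffel_symm (hG : IsMetricOn S G) (hz : z ∈ S) (b : ι → V) (k i j : ι) :
    christoffel S b G k i j z = christoffel S b G k j i z := by
  unfold christoffel
  congr 1
  refine Finset.sum_congr rfl fun l _ ↦ ?_
  rw [hG.matDeriv_symm hz (b l) i j]
  ring

theorem smooth_shape (hG : IsMetricOn S G) (hS : UniqueDiffOn ℝ S) (v : V) :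
    SmoothMatrixOn S (shape S v G) :=
  hG.inv.mul (hG.smooth.matDeriv hS v)

theorem contDiffOn_leafH (hG : IsMetricOn S G) (hS : UniqueDiffOn ℝ S) (v : V) :
    ContDiffOn ℝ ∞ (leafH S v G) S :=
  contDiffOn_const.mul (smooth_shape hG hS v).trace

theorem contDiffOn_leafSq (hG : IsMetricOn S G) (hS : UniqueDiffOn ℝ S) (v : V) :
    ContDiffOn ℝ ∞ (leafSq S v G) S :=
  contDiffOn_const.mul ((smooth_shape hG hS v).mul (smooth_shape hG hS v)).trace

theorem contDiffOn_grad (hG : IsMetricOn S G) (hS : UniqueDiffOn ℝ S) (b : ι → V)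
    (hφ : ContDiffOn ℝ ∞ φ S) (i : ι) : ContDiffOn ℝ ∞ (grad S b G φ i) S :=
  ContDiffOn.sum fun l _ ↦ (hG.inv i l).mul (hφ.pderiv hS _)

theorem contDiffOn_christoffel (hG : IsMetricOn S G) (hS : UniqueDiffOn ℝ S) (b : ι → V)
    (k i j : ι) : ContDiffOn ℝ ∞ (christoffel S b G k i j) S :=
  contDiffOn_const.mul <| ContDiffOn.sum fun l _ ↦ (hG.inv k l).mul <|
    (((hG.smooth j l).pderiv hS _).add ((hG.smooth i l).pderiv hS _)).sub
      ((hG.smooth i j).pderiv hS _)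

omit [NormedAddCommGroup V] [NormedSpace ℝ V] in
theorem warped_inv (hG : (G z).det ≠ 0) (hφ : φ z ≠ 0) :
    (warped G φ z)⁻¹ = Matrix.fromBlocks (G z)⁻¹ 0 0 (Matrix.of fun _ _ ↦ (φ z ^ 2)⁻¹) := by
  refine Matrix.inv_eq_right_inv ?_
  rw [warped, Matrix.fromBlocks_multiply, ← Matrix.fromBlocks_one]
  congr 1
  · simp [Matrix.mul_nonsing_inv _ (isUnit_iff_ne_zero.2 hG)]
  · simp
  · simp
  · ext i j
    simp [Matrix.mul_apply, hφ]

variable (b : ι ⊕ Unit → V)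

/-- In the names of these six lemmas the letters are the upper index followed by the two lower ones,
with `s` tangent to the leaf and `t` the normal direction. The omitted cases follow from
`christoffel_symm`. Only the symbols with two or more `t` indices, or with `t` as upper index,
involve the lapse. -/
theorem christoffel_warped_sss (hz : (G z).det ≠ 0) (h0 : φ z ≠ 0) (k i j : ι) :
    christoffel S b (warped G φ) (.inl k) (.inl i) (.inl j) z
      = christoffel S (fun i ↦ b (.inl i)) G k i j z := by
  simp only [christoffel, Fintype.sum_sum_type, warped_inv hz h0]
  simp [warped]

theorem christoffel_warped_sst (hz : (G z).det ≠ 0) (h0 : φ z ≠ 0) (k i : ι) :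
    christoffel S b (warped G φ) (.inl k) (.inl i) (.inr ()) z
      = 1 / 2 * ∑ l, (G z)⁻¹ k l * pderiv S (b (.inr ())) (fun z ↦ G z i l) z := by
  simp only [christoffel, Fintype.sum_sum_type, warped_inv hz h0]
  simp [warped, pderiv_const]

theorem christoffel_warped_stt (hS : UniqueDiffOn ℝ S) (hz : (G z).det ≠ 0) (h0 : φ z ≠ 0)
    (hφ : ContDiffOn ℝ ∞ φ S) (hzS : z ∈ S) (k : ι) :
    christoffel S b (warped G φ) (.inl k) (.inr ()) (.inr ()) z
      = -(φ z * grad S (fun i ↦ b (.inl i)) G φ k z) := by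
  have h2 : ∀ v, pderiv S v (fun z ↦ φ z ^ 2) z = 2 * φ z * pderiv S v φ z := by
    intro v
    simp only [pow_two]
    rw [pderiv_mul hS hzS hφ.differentiableOn_infty hφ.differentiableOn_infty]
    ring
  simp only [christoffel, Fintype.sum_sum_type, warped_inv hz h0]
  simp only [warped, Matrix.fromBlocks_apply₁₁, Matrix.fromBlocks_apply₁₂,
    Matrix.fromBlocks_apply₂₁, Matrix.fromBlocks_apply₂₂, Matrix.zero_apply, pderiv_const,
    Matrix.of_apply, h2, grad, Finset.mul_sum, zero_mul, Finset.sum_const_zero, add_zero,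
    ← Finset.sum_neg_distrib]
  exact Finset.sum_congr rfl fun l _ ↦ by ring

theorem christoffel_warped_tss (hz : (G z).det ≠ 0) (h0 : φ z ≠ 0) (i j : ι) :
    christoffel S b (warped G φ) (.inr ()) (.inl i) (.inl j) z
      = -(1 / 2) * ((φ z)⁻¹ ^ 2 * pderiv S (b (.inr ())) (fun z ↦ G z i j) z) := by
  simp only [christoffel, Fintype.sum_sum_type, warped_inv hz h0]
  simp [warped, pderiv_const]

theorem christoffel_warped_tst (hS : UniqueDiffOn ℝ S) (hz : (G z).det ≠ 0) (h0 : φ z ≠ 0)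
    (hφ : ContDiffOn ℝ ∞ φ S) (hzS : z ∈ S) (i : ι) :
    christoffel S b (warped G φ) (.inr ()) (.inl i) (.inr ()) z
      = pderiv S (b (.inl i)) φ z * (φ z)⁻¹ := by
  have h2 : ∀ v, pderiv S v (fun z ↦ φ z ^ 2) z = 2 * φ z * pderiv S v φ z := by
    intro v
    simp only [pow_two]
    rw [pderiv_mul hS hzS hφ.differentiableOn_infty hφ.differentiableOn_infty]
    ring
  simp only [christoffel, Fintype.sum_sum_type, warped_inv hz h0]
  simp [warped, pderiv_const, h2]
  field_simp

theorem christoffel_warped_ttt (hS : UniqueDiffOn ℝ S) (hz : (G z).det ≠ 0) (h0 : φ z ≠ 0)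
    (hφ : ContDiffOn ℝ ∞ φ S) (hzS : z ∈ S) :
    christoffel S b (warped G φ) (.inr ()) (.inr ()) (.inr ()) z
      = pderiv S (b (.inr ())) φ z * (φ z)⁻¹ := by
  have h2 : ∀ v, pderiv S v (fun z ↦ φ z ^ 2) z = 2 * φ z * pderiv S v φ z := by
    intro v
    simp only [pow_two]
    rw [pderiv_mul hS hzS hφ.differentiableOn_infty hφ.differentiableOn_infty]
    ring
  simp only [christoffel, Fintype.sum_sum_type, warped_inv hz h0]
  simp [warped, h2]
  field_simp

end Warped

/-! ### Ricci and scalar curvature of `G + φ² dt²`. -/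

section Ricci

variable {V : Type*} [NormedAddCommGroup V] [NormedSpace ℝ V] {S : Set V}
  {ι : Type*} [Fintype ι] [DecidableEq ι] {z : V} {G : V → Matrix ι ι ℝ} {φ : V → ℝ}

theorem isMetricOn_warped (hG : IsMetricOn S G) (hφ : ContDiffOn ℝ ∞ φ S)
    (h0 : ∀ z ∈ S, φ z ≠ 0) : IsMetricOn S (warped G φ) where
  smooth := by
    rintro (i | i) (j | j)
    · exact hG.smooth i j
    · exact contDiffOn_const
    · exact contDiffOn_const
    · exact hφ.pow 2
  symm := by
    rintro z hz (i | i) (j | j)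
    · exact hG.symm z hz i j
    · rfl
    · rfl
    · rfl
  det_pos := by
    intro z hz
    rw [warped, Matrix.det_fromBlocks_zero₂₁, Matrix.det_unique (Matrix.of _)]
    exact mul_pos (hG.det_pos z hz) (pow_two_pos_of_ne_zero (h0 z hz))

variable (b : ι ⊕ Unit → V)

/-- Identifies the mixed Christoffel symbols `Γ^k_{it}` with half of `shape`. -/
theorem sum_inv_mul_pderiv (hG : IsMetricOn S G) (hz : z ∈ S) (v : V) (k i : ι) :
    ∑ l, (G z)⁻¹ k l * pderiv S v (fun z ↦ G z i l) z = shape S v G z k i := by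
  simp only [shape, Matrix.mul_apply, matDeriv_apply]
  exact Finset.sum_congr rfl fun l _ ↦ by rw [hG.matDeriv_symm hz v i l]

theorem matDeriv_shape (hG : IsMetricOn S G) (hS : UniqueDiffOn ℝ S) (hz : z ∈ S) (v : V) :
    matDeriv S v (shape S v G) z
      = -(shape S v G z * shape S v G z) + (G z)⁻¹ * matDeriv S v (matDeriv S v G) z := by
  unfold shape
  rw [matDeriv_mul hG.inv (hG.smooth.matDeriv hS v) hS hz, matDeriv_inv hG.smooth hG.det_ne hS hz]
  simp only [Matrix.neg_mul, Matrix.mul_assoc]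

/-- Trades the trace of `∂_v² G`, which appears in the tangential Ricci components, for the
derivative of the mean curvature. -/
theorem pderiv_leafH (hG : IsMetricOn S G) (hS : UniqueDiffOn ℝ S) (hz : z ∈ S) (v : V) :
    pderiv S v (leafH S v G) z
      = -2 * leafSq S v G z + 1 / 2 * ((G z)⁻¹ * matDeriv S v (matDeriv S v G) z).trace := by
  unfold leafH
  rw [pderiv_const_mul hS hz (smooth_shape hG hS v).trace.differentiableOn_infty,
    pderiv_trace (smooth_shape hG hS v) hS hz, matDeriv_shape hG hS hz, Matrix.trace_add,
    Matrix.trace_neg, leafSq]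
  ring

theorem pderiv_leafH_eq_sum (hG : IsMetricOn S G) (hS : UniqueDiffOn ℝ S) (hz : z ∈ S) (v : V) :
    pderiv S v (leafH S v G) z
      = ∑ i, 1 / 2 * pderiv S v (fun z ↦ shape S v G z i i) z := by
  unfold leafH
  rw [pderiv_const_mul hS hz (smooth_shape hG hS v).trace.differentiableOn_infty,
    pderiv_trace (smooth_shape hG hS v) hS hz, ← Finset.mul_sum]
  rfl

omit [DecidableEq ι] in
/-- The index computation relating the divergence of the gradient and the trace of the Hessian. -/
theorem sum_christoffel_trace {A : Matrix ι ι ℝ} {D : ι → Matrix ι ι ℝ}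
    (hA : ∀ i j, A i j = A j i) (hD : ∀ i j k, D i j k = D i k j) (φ : ι → ℝ) :
    ∑ i, ∑ l, (A * D i * A) i l * φ l
      = ∑ i, ∑ k, (1 / 2 * ∑ l, A i l * (D i k l + D k i l - D l i k)) * ∑ l, A k l * φ l
        + ∑ j, ∑ k, A j k * ∑ p, φ p * (1 / 2 * ∑ l, A p l * (D j k l + D k j l - D l j k)) := by
  set F : ι → ℝ := fun k ↦ ∑ l, A k l * φ l with hF
  have h1 : ∑ i, ∑ l, (A * D i * A) i l * φ l = ∑ i, ∑ j, ∑ k, A i j * D i j k * F k := by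
    refine Finset.sum_congr rfl fun i _ ↦ ?_
    simp only [Matrix.mul_apply, hF, Finset.sum_mul, Finset.mul_sum]
    rw [Finset.sum_comm' (t' := Finset.univ) (s' := fun _ ↦ Finset.univ) (by simp)]
    conv_rhs => rw [Finset.sum_comm]
    refine Finset.sum_congr rfl fun k _ ↦ ?_
    rw [Finset.sum_comm]
    exact Finset.sum_congr rfl fun j _ ↦ Finset.sum_congr rfl fun l _ ↦ by ring
  have h2 : ∑ i, ∑ k, (1 / 2 * ∑ l, A i l * (D i k l + D k i l - D l i k)) * F k
      = 1 / 2 * ∑ i, ∑ j, ∑ k, A i j * D k i j * F k := by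
    -- As `A` is symmetric, exchanging `i` and `l` cancels the first term of the Christoffel symbol
    -- against the third.
    have e : ∑ i, ∑ k, ∑ l, A i l * D i k l * F k = ∑ i, ∑ k, ∑ l, A i l * D l i k * F k := by
      rw [Finset.sum_comm]
      conv_rhs => rw [Finset.sum_comm]
      refine Finset.sum_congr rfl fun k _ ↦ ?_
      rw [Finset.sum_comm]
      exact Finset.sum_congr rfl fun i _ ↦ Finset.sum_congr rfl fun l _ ↦ by
        rw [hA i l, hD l k i]
    have e' : ∀ i, ∑ j, ∑ k, A i j * D k i j * F k = ∑ k, ∑ j, A i j * D k i j * F k :=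
      fun i ↦ Finset.sum_comm
    simp only [e', Finset.mul_sum, Finset.sum_mul]
    have e'' : ∀ i k l, 1 / 2 * (A i l * (D i k l + D k i l - D l i k)) * F k
        = 1 / 2 * (A i l * D k i l * F k)
          + 1 / 2 * (A i l * D i k l * F k - A i l * D l i k * F k) := fun i k l ↦ by ring
    simp only [e'', Finset.sum_add_distrib, ← Finset.mul_sum, Finset.sum_sub_distrib]
    rw [e]
    ring
  have h3 : ∑ j, ∑ k, A j k * ∑ p, φ p * (1 / 2 * ∑ l, A p l * (D j k l + D k j l - D l j k))
      = ∑ i, ∑ j, ∑ k, A i j * D i j k * F k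
        - 1 / 2 * ∑ i, ∑ j, ∑ k, A i j * D k i j * F k := by
    have e : ∀ j k, A j k * ∑ p, φ p * (1 / 2 * ∑ l, A p l * (D j k l + D k j l - D l j k))
        = ∑ l, 1 / 2 * (A j k * (D j k l + D k j l - D l j k) * F l) := by
      intro j k
      simp only [hF, Finset.mul_sum]
      rw [Finset.sum_comm]
      exact Finset.sum_congr rfl fun l _ ↦ Finset.sum_congr rfl fun p _ ↦ by
        rw [hA p l]
        ring
    -- Contracted with a symmetric matrix, the first two terms of the Christoffel symbol contribute
    -- equally.
    have e' : ∑ i, ∑ j, ∑ k, A i j * D j i k * F k = ∑ i, ∑ j, ∑ k, A i j * D i j k * F k := by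
      rw [Finset.sum_comm]
      exact Finset.sum_congr rfl fun j _ ↦ Finset.sum_congr rfl fun i _ ↦ by rw [hA]
    simp only [e]
    simp only [mul_add, add_mul, mul_sub, sub_mul, Finset.sum_add_distrib,
      Finset.sum_sub_distrib, ← Finset.mul_sum, e']
    ring
  rw [h1, h2, h3]
  ring

/-- The divergence form appears in `Ric(∂_t, ∂_t)` and is the one that integrates to zero, while the
tangential Ricci components produce the Hessian. The two agree because differentiating `G⁻¹` inside
the gradient gives exactly the Christoffel terms in which they differ. -/
theorem laplacian_eq (hG : IsMetricOn S G) (hS : UniqueDiffOn ℝ S) (hz : z ∈ S)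
    (hφ : ContDiffOn ℝ ∞ φ S) (b : ι → V) :
    laplacian S b G φ z = ∑ j, ∑ k, (G z)⁻¹ j k * (pderiv S (b j) (pderiv S (b k) φ) z
      - ∑ p, pderiv S (b p) φ z * christoffel S b G p j k z) := by
  have hd : ∀ v i l, pderiv S v (fun z ↦ (G z)⁻¹ i l) z
      = -((G z)⁻¹ * matDeriv S v G z * (G z)⁻¹) i l := fun v i l ↦ by
    rw [← matDeriv_apply (fun z ↦ (G z)⁻¹), matDeriv_inv hG.smooth hG.det_ne hS hz]
    rfl
  have hgr : ∀ i, pderiv S (b i) (grad S b G φ i) z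
      = ∑ l, (-((G z)⁻¹ * matDeriv S (b i) G z * (G z)⁻¹) i l * pderiv S (b l) φ z
        + (G z)⁻¹ i l * pderiv S (b i) (pderiv S (b l) φ) z) := fun i ↦ by
    unfold grad
    rw [pderiv_sum hS hz fun l _ ↦ ((hG.inv i l).mul (hφ.pderiv hS _)).differentiableOn_infty]
    refine Finset.sum_congr rfl fun l _ ↦ ?_
    rw [pderiv_mul hS hz (hG.inv i l).differentiableOn_infty (hφ.pderiv hS _).differentiableOn_infty,
      hd]
  have key := sum_christoffel_trace (fun i j ↦ hG.inv_symm hz i j)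
    (D := fun i ↦ matDeriv S (b i) G z) (fun i k l ↦ hG.matDeriv_symm hz (b i) k l)
    (fun l ↦ pderiv S (b l) φ z)
  simp only [laplacian, hgr, Finset.sum_add_distrib, mul_sub, Finset.sum_sub_distrib]
  simp only [neg_mul, Finset.sum_neg_distrib]
  rw [key]
  simp only [grad, christoffel, matDeriv_apply]
  ring

/-- The traced Riccati equation for the second fundamental form. The Laplacian is the divergence of
`Γ^i_{tt} = -φ ∇^i φ`, and `|h|²` is the trace of the square of `Γ^i_{tk}`. -/
theorem ricci_warped_tt (hG : IsMetricOn S G) (hS : UniqueDiffOn ℝ S) (hz : z ∈ S)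
    (hφ : ContDiffOn ℝ ∞ φ S) (h0 : ∀ z ∈ S, φ z ≠ 0) :
    ricci S b (warped G φ) (.inr ()) (.inr ()) z
      = -(φ z * laplacian S (fun i ↦ b (.inl i)) G φ z)
        - pderiv S (b (.inr ())) (leafH S (b (.inr ())) G) z
        + leafH S (b (.inr ())) G z * (pderiv S (b (.inr ())) φ z * (φ z)⁻¹)
        - leafSq S (b (.inr ())) G z := by
  have hw := isMetricOn_warped hG hφ h0
  have e1 : ∀ w ∈ S, ∀ k i, christoffel S b (warped G φ) (.inl k) (.inl i) (.inr ()) w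
      = 1 / 2 * shape S (b (.inr ())) G w k i := fun w hw' k i ↦ by
    rw [christoffel_warped_sst b (hG.det_ne w hw') (h0 w hw'), sum_inv_mul_pderiv hG hw']
  have e2 : ∀ w ∈ S, ∀ k i, christoffel S b (warped G φ) (.inl k) (.inr ()) (.inl i) w
      = 1 / 2 * shape S (b (.inr ())) G w k i := fun w hw' k i ↦ by
    rw [christoffel_symm hw hw', e1 w hw']
  have e3 : ∀ w ∈ S, ∀ k, christoffel S b (warped G φ) (.inl k) (.inr ()) (.inr ()) w
      = -(φ w * grad S (fun i ↦ b (.inl i)) G φ k w) := fun w hw' k ↦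
    christoffel_warped_stt b hS (hG.det_ne w hw') (h0 w hw') hφ hw' k
  have e4 := christoffel_warped_ttt b hS (hG.det_ne z hz) (h0 z hz) hφ hz
  have e5 : ∀ i, christoffel S b (warped G φ) (.inr ()) (.inl i) (.inr ()) z = _ :=
    christoffel_warped_tst b hS (hG.det_ne z hz) (h0 z hz) hφ hz
  have e6 : ∀ k i j, christoffel S b (warped G φ) (.inl k) (.inl i) (.inl j) z = _ :=
    christoffel_warped_sss b (hG.det_ne z hz) (h0 z hz)
  have hgr := contDiffOn_grad hG hS (fun i ↦ b (.inl i)) hφ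
  have d1 : ∀ i, pderiv S (b (.inl i))
      (christoffel S b (warped G φ) (.inl i) (.inr ()) (.inr ())) z
      = -(pderiv S (b (.inl i)) φ z * grad S (fun i ↦ b (.inl i)) G φ i z
        + φ z * pderiv S (b (.inl i)) (grad S (fun i ↦ b (.inl i)) G φ i) z) := fun i ↦ by
    rw [pderiv_congr (fun w hw' ↦ e3 w hw' i) hz, pderiv_neg hS hz,
      pderiv_mul hS hz hφ.differentiableOn_infty (hgr i).differentiableOn_infty]
  have d2 : ∀ i, pderiv S (b (.inr ()))
      (christoffel S b (warped G φ) (.inl i) (.inl i) (.inr ())) z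
      = 1 / 2 * pderiv S (b (.inr ())) (fun w ↦ shape S (b (.inr ())) G w i i) z := fun i ↦ by
    rw [pderiv_congr (fun w hw' ↦ e1 w hw' i i) hz,
      pderiv_const_mul hS hz (smooth_shape hG hS _ i i).differentiableOn_infty]
  -- The normal term of the trace vanishes by antisymmetry. The product `Γ^i_{tt} Γ^t_{it}` cancels
  -- the term `∂_i φ ∇^i φ` that arises from the factor `φ` in `Γ^i_{tt}`.
  simp only [ricci, riemann, Fintype.sum_sum_type, Finset.univ_unique, Finset.sum_singleton,
    PUnit.default_eq_unit, sub_self, Finset.sum_const_zero, add_zero, e1 z hz, e2 z hz, e3 z hz,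
    e4, e5, e6, d1, d2]
  rw [pderiv_leafH_eq_sum hG hS hz]
  simp only [leafH, leafSq, laplacian, Matrix.trace, Matrix.diag, Matrix.mul_apply]
  rw [Finset.mul_sum, Finset.mul_sum, Finset.mul_sum, Finset.sum_mul, ← Finset.sum_neg_distrib,
    ← Finset.sum_sub_distrib, ← Finset.sum_add_distrib, ← Finset.sum_sub_distrib]
  refine Finset.sum_congr rfl fun i _ ↦ ?_
  have := h0 z hz
  rw [Finset.sum_sub_distrib, Finset.mul_sum]
  have s1 : ∀ (c d : ι → ℝ) (f : ℝ), ∑ k, c k * -(f * d k) = -(f * ∑ k, c k * d k) := by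
    intro c d f
    rw [Finset.mul_sum, ← Finset.sum_neg_distrib]
    exact Finset.sum_congr rfl fun k _ ↦ by ring
  have s2 : ∀ k, 1 / 2 * shape S (b (.inr ())) G z i k * (1 / 2 * shape S (b (.inr ())) G z k i)
      = 1 / 4 * (shape S (b (.inr ())) G z i k * shape S (b (.inr ())) G z k i) :=
    fun k ↦ by ring
  rw [s1]
  simp only [s2]
  field_simp
  ring

omit [DecidableEq ι] in
theorem sum_mul_combination (A R T W T' L W' : ι → ι → ℝ) (a h c a' d e : ℝ) :
    ∑ j, ∑ k, A j k * (R j k - a * (h * T j k - 1 / 2 * W j k)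
        + (c * T j k - a' * T' j k - d * L j k + e * W' j k))
      = ∑ j, ∑ k, A j k * R j k
        - a * (h * ∑ j, ∑ k, A j k * T j k - 1 / 2 * ∑ j, ∑ k, A j k * W j k)
        + (c * ∑ j, ∑ k, A j k * T j k - a' * ∑ j, ∑ k, A j k * T' j k
          - d * ∑ j, ∑ k, A j k * L j k + e * ∑ j, ∑ k, A j k * W' j k) := by
  simp only [Finset.mul_sum, ← Finset.sum_sub_distrib, ← Finset.sum_add_distrib]
  exact Finset.sum_congr rfl fun j _ ↦ Finset.sum_congr rfl fun k _ ↦ by ring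

/-- The traced Gauss equation before adding the normal component: the sum is `R - Ric(ν, ν)` with `ν
= φ⁻¹ ∂_t`. Keeping `Ric(∂_t, ∂_t)` on the right absorbs all terms with `Δφ`, `∂_t φ` and `∂_t H`.
-/
theorem sum_inv_mul_ricci_warped (hG : IsMetricOn S G) (hS : UniqueDiffOn ℝ S) (hz : z ∈ S)
    (hφ : ContDiffOn ℝ ∞ φ S) (h0 : ∀ z ∈ S, φ z ≠ 0) :
    ∑ j, ∑ k, (G z)⁻¹ j k * ricci S b (warped G φ) (.inl j) (.inl k) z
      = scalarCurv S (fun i ↦ b (.inl i)) G z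
      + (leafSq S (b (.inr ())) G z - leafH S (b (.inr ())) G z ^ 2) * (φ z)⁻¹ ^ 2
      + ricci S b (warped G φ) (.inr ()) (.inr ()) z * (φ z)⁻¹ ^ 2 := by
  have hw := isMetricOn_warped hG hφ h0
  have hz0 := h0 z hz
  have e1 : ∀ w ∈ S, ∀ k i, christoffel S b (warped G φ) (.inl k) (.inl i) (.inr ()) w
      = 1 / 2 * shape S (b (.inr ())) G w k i := fun w hw' k i ↦ by
    rw [christoffel_warped_sst b (hG.det_ne w hw') (h0 w hw'), sum_inv_mul_pderiv hG hw']
  have e2 : ∀ w ∈ S, ∀ k i, christoffel S b (warped G φ) (.inl k) (.inr ()) (.inl i) w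
      = 1 / 2 * shape S (b (.inr ())) G w k i := fun w hw' k i ↦ by
    rw [christoffel_symm hw hw', e1 w hw']
  have e3 : ∀ w ∈ S, ∀ i j, christoffel S b (warped G φ) (.inr ()) (.inl i) (.inl j) w
      = -(1 / 2) * ((φ w)⁻¹ ^ 2 * matDeriv S (b (.inr ())) G w i j) := fun w hw' i j ↦
    christoffel_warped_tss b (hG.det_ne w hw') (h0 w hw') i j
  have e4 := christoffel_warped_ttt b hS (hG.det_ne z hz) (h0 z hz) hφ hz
  have e5 : ∀ w ∈ S, ∀ i, christoffel S b (warped G φ) (.inr ()) (.inl i) (.inr ()) w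
      = pderiv S (b (.inl i)) φ w * (φ w)⁻¹ := fun w hw' i ↦
    christoffel_warped_tst b hS (hG.det_ne w hw') (h0 w hw') hφ hw' i
  have e5' : ∀ w ∈ S, ∀ i, christoffel S b (warped G φ) (.inr ()) (.inr ()) (.inl i) w
      = pderiv S (b (.inl i)) φ w * (φ w)⁻¹ := fun w hw' i ↦ by
    rw [christoffel_symm hw hw', e5 w hw']
  have e6 : ∀ w ∈ S, ∀ k i j, christoffel S b (warped G φ) (.inl k) (.inl i) (.inl j) w
      = christoffel S (fun i ↦ b (.inl i)) G k i j w := fun w hw' ↦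
    christoffel_warped_sss b (hG.det_ne w hw') (h0 w hw')
  have hinv : ContDiffOn ℝ ∞ (fun w ↦ (φ w)⁻¹) S := hφ.inv h0
  have hdG := hG.smooth.matDeriv hS (b (.inr ()))
  have dinv : ∀ v, pderiv S v (fun w ↦ (φ w)⁻¹) z = -pderiv S v φ z * (φ z)⁻¹ ^ 2 := fun v ↦ by
    rw [pderiv_inv hS hz hφ.differentiableOn_infty h0]
    field_simp
  have dinv2 : ∀ v, pderiv S v (fun w ↦ (φ w)⁻¹ ^ 2) z = -2 * pderiv S v φ z * (φ z)⁻¹ ^ 3 := by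
    intro v
    simp only [pow_two]
    rw [pderiv_mul hS hz hinv.differentiableOn_infty hinv.differentiableOn_infty, dinv]
    ring
  have d1 : ∀ j k, pderiv S (b (.inr ()))
      (christoffel S b (warped G φ) (.inr ()) (.inl j) (.inl k)) z
      = -(1 / 2) * (-2 * pderiv S (b (.inr ())) φ z * (φ z)⁻¹ ^ 3 * matDeriv S (b (.inr ())) G z j k
        + (φ z)⁻¹ ^ 2 * matDeriv S (b (.inr ())) (matDeriv S (b (.inr ())) G) z j k) := by
    intro j k
    rw [pderiv_congr (fun w hw' ↦ e3 w hw' j k) hz,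
      pderiv_const_mul hS hz ((hinv.pow 2).mul (hdG j k)).differentiableOn_infty,
      pderiv_mul hS hz (hinv.pow 2).differentiableOn_infty (hdG j k).differentiableOn_infty, dinv2]
    rfl
  have d2 : ∀ j k, pderiv S (b (.inl j))
      (christoffel S b (warped G φ) (.inr ()) (.inr ()) (.inl k)) z
      = pderiv S (b (.inl j)) (pderiv S (b (.inl k)) φ) z * (φ z)⁻¹
        - pderiv S (b (.inl k)) φ z * (pderiv S (b (.inl j)) φ z * (φ z)⁻¹ ^ 2) := by
    intro j k
    rw [pderiv_congr (fun w hw' ↦ e5' w hw' k) hz,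
      pderiv_mul hS hz (hφ.pderiv hS _).differentiableOn_infty hinv.differentiableOn_infty, dinv]
    ring
  have d3 : ∀ v l i k, pderiv S v (christoffel S b (warped G φ) (.inl l) (.inl i) (.inl k)) z
      = pderiv S v (christoffel S (fun i ↦ b (.inl i)) G l i k) z := fun v l i k ↦
    pderiv_congr (fun w hw' ↦ e6 w hw' l i k) hz
  -- Trace over the leaf directions: the intrinsic Ricci tensor and quadratic terms in `∂_t G`.
  have r1 : ∀ j k, ∑ i, riemann S b (warped G φ) (.inl i) (.inl k) (.inl i) (.inl j) z
      = ricci S (fun i ↦ b (.inl i)) G j k z - 1 / 2 * (φ z)⁻¹ ^ 2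
        * (leafH S (b (.inr ())) G z * matDeriv S (b (.inr ())) G z j k
          - 1 / 2 * ∑ i, shape S (b (.inr ())) G z i j * matDeriv S (b (.inr ())) G z i k) := by
    intro j k
    simp only [ricci, riemann, Fintype.sum_sum_type, Finset.univ_unique, Finset.sum_singleton,
      PUnit.default_eq_unit, e1 z hz, e3 z hz, e6 z hz, d3, leafH, Matrix.trace,
      Matrix.diag]
    simp only [Finset.mul_sum, Finset.sum_mul, ← Finset.sum_sub_distrib]
    refine Finset.sum_congr rfl fun i _ ↦ ?_
    ring
  -- The normal direction: here the Hessian of `φ` and the second `t`-derivative of `G` enter.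
  have r2 : ∀ j k, riemann S b (warped G φ) (.inr ()) (.inl k) (.inr ()) (.inl j) z
      = (1 / 2 * pderiv S (b (.inr ())) φ z * (φ z)⁻¹ ^ 3) * matDeriv S (b (.inr ())) G z j k
        - 1 / 2 * (φ z)⁻¹ ^ 2 * matDeriv S (b (.inr ())) (matDeriv S (b (.inr ())) G) z j k
        - (φ z)⁻¹ * (pderiv S (b (.inl j)) (pderiv S (b (.inl k)) φ) z
          - ∑ p, pderiv S (b (.inl p)) φ z * christoffel S (fun i ↦ b (.inl i)) G p j k z)
        + 1 / 4 * (φ z)⁻¹ ^ 2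
          * ∑ p, matDeriv S (b (.inr ())) G z j p * shape S (b (.inr ())) G z p k := by
    intro j k
    simp only [riemann, Fintype.sum_sum_type, Finset.univ_unique, Finset.sum_singleton,
      PUnit.default_eq_unit, e2 z hz, e3 z hz, e4, e5 z hz, e5' z hz, e6 z hz, d1, d2]
    rw [Finset.sum_sub_distrib]
    have s1 : ∀ (c d : ι → ℝ) (f : ℝ), ∑ k, c k * f * d k = f * ∑ k, c k * d k := by
      intro c d f
      rw [Finset.mul_sum]
      exact Finset.sum_congr rfl fun k _ ↦ by ring
    have s2 : ∀ (c d : ι → ℝ) (f : ℝ), ∑ k, -(1 / 2) * (f * c k) * (1 / 2 * d k)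
        = -(1 / 4) * f * ∑ k, c k * d k := by
      intro c d f
      rw [Finset.mul_sum]
      exact Finset.sum_congr rfl fun k _ ↦ by ring
    rw [s1, s2]
    field_simp
    ring
  have hsym : ∀ j k, matDeriv S (b (.inr ())) G z j k = matDeriv S (b (.inr ())) G z k j :=
    hG.matDeriv_symm hz _
  have t1 : ∑ j, ∑ k, (G z)⁻¹ j k * matDeriv S (b (.inr ())) G z j k
      = 2 * leafH S (b (.inr ())) G z := by
    simp only [leafH, shape, Matrix.trace, Matrix.diag, Matrix.mul_apply]
    rw [← mul_assoc, mul_one_div_cancel two_ne_zero, one_mul]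
    exact Finset.sum_congr rfl fun j _ ↦ Finset.sum_congr rfl fun k _ ↦ by rw [hsym]
  have hsh : ∀ i j, shape S (b (.inr ())) G z i j
      = ∑ k, (G z)⁻¹ i k * matDeriv S (b (.inr ())) G z k j := fun i j ↦ rfl
  have hSq : 4 * leafSq S (b (.inr ())) G z
      = ∑ i, ∑ j, shape S (b (.inr ())) G z i j * shape S (b (.inr ())) G z j i := by
    simp only [leafSq, Matrix.trace, Matrix.diag, Matrix.mul_apply]
    ring
  have t2 : ∑ j, ∑ k, (G z)⁻¹ j k * ∑ i, shape S (b (.inr ())) G z i j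
      * matDeriv S (b (.inr ())) G z i k = 4 * leafSq S (b (.inr ())) G z := by
    rw [hSq]
    conv_rhs => rw [Finset.sum_comm]
    refine Finset.sum_congr rfl fun j _ ↦ ?_
    conv_rhs => enter [2, i]; rw [hsh j i, Finset.mul_sum]
    rw [Finset.sum_comm]
    refine Finset.sum_congr rfl fun k _ ↦ ?_
    rw [Finset.mul_sum]
    exact Finset.sum_congr rfl fun i _ ↦ by rw [hsym i k]; ring
  have t3 : ∑ j, ∑ k, (G z)⁻¹ j k * ∑ p, matDeriv S (b (.inr ())) G z j p
      * shape S (b (.inr ())) G z p k = 4 * leafSq S (b (.inr ())) G z := by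
    rw [hSq]
    conv_lhs => rw [Finset.sum_comm]
    conv_rhs => rw [Finset.sum_comm]
    refine Finset.sum_congr rfl fun k _ ↦ ?_
    conv_rhs => enter [2, i]; rw [hsh k i, Finset.mul_sum]
    rw [Finset.sum_comm]
    refine Finset.sum_congr rfl fun j _ ↦ ?_
    rw [Finset.mul_sum]
    exact Finset.sum_congr rfl fun p _ ↦ by rw [hG.inv_symm hz j k]; ring
  have t4 : ∑ j, ∑ k, (G z)⁻¹ j k * matDeriv S (b (.inr ())) (matDeriv S (b (.inr ())) G) z j k
      = 2 * pderiv S (b (.inr ())) (leafH S (b (.inr ())) G) z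
        + 4 * leafSq S (b (.inr ())) G z := by
    rw [pderiv_leafH hG hS hz]
    simp only [Matrix.trace, Matrix.diag, Matrix.mul_apply]
    have hsym' : ∀ j k, matDeriv S (b (.inr ())) (matDeriv S (b (.inr ())) G) z k j
        = matDeriv S (b (.inr ())) (matDeriv S (b (.inr ())) G) z j k := fun j k ↦
      pderiv_congr (fun w hw' ↦ hG.matDeriv_symm hw' _ k j) hz
    simp only [hsym']
    ring
  have t5 := laplacian_eq hG hS hz hφ (fun i ↦ b (.inl i))
  rw [ricci_warped_tt b hG hS hz hφ h0]
  have r3 : ∀ j k, ricci S b (warped G φ) (.inl j) (.inl k) z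
      = ∑ i, riemann S b (warped G φ) (.inl i) (.inl k) (.inl i) (.inl j) z
        + riemann S b (warped G φ) (.inr ()) (.inl k) (.inr ()) (.inl j) z := fun j k ↦ by
    simp only [ricci, Fintype.sum_sum_type, Finset.univ_unique, Finset.sum_singleton,
      PUnit.default_eq_unit]
  simp only [r3, r1, r2]
  refine (sum_mul_combination (fun j k ↦ (G z)⁻¹ j k) _ _ _ _ _ _ _ _ _ _ _ _).trans ?_
  simp only [t1, t2, t3, t4, ← t5, scalarCurv]
  field_simp
  ring

theorem scalarCurv_warped (hG : IsMetricOn S G) (hS : UniqueDiffOn ℝ S) (hz : z ∈ S)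
    (hφ : ContDiffOn ℝ ∞ φ S) (h0 : ∀ z ∈ S, φ z ≠ 0) :
    scalarCurv S b (warped G φ) z = scalarCurv S (fun i ↦ b (.inl i)) G z
      + (leafSq S (b (.inr ())) G z - leafH S (b (.inr ())) G z ^ 2) * (φ z)⁻¹ ^ 2
      + 2 * (ricci S b (warped G φ) (.inr ()) (.inr ()) z * (φ z)⁻¹ ^ 2) := by
  have h := sum_inv_mul_ricci_warped b hG hS hz hφ h0
  simp only [scalarCurv, Fintype.sum_sum_type, warped_inv (hG.det_ne z hz) (h0 z hz),
    Matrix.fromBlocks_apply₁₁, Matrix.fromBlocks_apply₁₂, Matrix.fromBlocks_apply₂₁,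
    Matrix.fromBlocks_apply₂₂, Matrix.zero_apply, Matrix.of_apply, Finset.univ_unique,
    Finset.sum_singleton, PUnit.default_eq_unit, zero_mul, add_zero, zero_add,
    Finset.sum_const_zero] at h ⊢
  rw [h, inv_pow]
  ring

end Ricci

end CoordGeom

namespace Foliation

open CoordGeom

/-! ### Behaviour of the metric components under a change of chart. -/

section ChangeOfChart

variable {m : ℕ} {M : Type*} [TopologicalSpace M] [ChartedSpace (Model m) M]
  [IsManifold 𝓘(ℝ, Model m) ∞ M] {e e' : OpenPartialHomeomorph M (Model m)} {p : M}

theorem sum_smul_frame (v : Model m) : v = ∑ k, v k • frame m k := by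
  simpa [frame] using ((EuclideanSpace.basisFun (Fin m) ℝ).sum_repr v).symm

instance : IsManifold 𝓘(ℝ, Model m) 1 M := IsManifold.of_le (n := ∞) (by simp)

/-- The inner product `g_p` as a bilinear form on the model space. -/
def innerAt (g : SmoothMetric m M) (p : M) : Model m →L[ℝ] Model m →L[ℝ] ℝ :=
  g.inner p

/-- The coordinate vector field `∂_i` of the chart `e` at the point `p`. -/
def tangentFrame (e : OpenPartialHomeomorph M (Model m)) (p : M) (i : Fin m) : Model m :=
  coordVec e i (e p)

/-- The Jacobian matrix of the coordinate change from `e` to `e'`. -/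
def jacobian (e e' : OpenPartialHomeomorph M (Model m)) (p : M) : Matrix (Fin m) (Fin m) ℝ :=
  Matrix.of fun k i ↦ fderiv ℝ (e' ∘ e.symm) (e p) (frame m i) k

theorem metricMatrix_chart (g : SmoothMetric m M) (hp : p ∈ e.source) (i j : Fin m) :
    metricMatrix g e (e p) i j = innerAt g p (tangentFrame e p i) (tangentFrame e p j) := by
  change innerAt g (e.symm (e p)) (tangentFrame e p i) (tangentFrame e p j) = _
  rw [e.left_inv hp]

theorem contDiffAt_transition (he : e ∈ atlas (Model m) M) (he' : e' ∈ atlas (Model m) M)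
    (hp : p ∈ e.source) (hp' : p ∈ e'.source) : ContDiffAt ℝ ∞ (e' ∘ e.symm) (e p) := by
  rw [← contMDiffAt_iff_contDiffAt]
  refine ContMDiffAt.comp (I' := 𝓘(ℝ, Model m)) (e p) ?_ ?_
  · rw [e.left_inv hp]
    exact contMDiffAt_of_mem_maximalAtlas (IsManifold.subset_maximalAtlas he') hp'
  · exact contMDiffAt_symm_of_mem_maximalAtlas (IsManifold.subset_maximalAtlas he)
      (e.map_source hp)

omit [ChartedSpace (Model m) M] [IsManifold 𝓘(ℝ, Model m) ∞ M] in
theorem symm_eventuallyEq (hp : p ∈ e.source) (hp' : p ∈ e'.source) :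
    e'.symm ∘ (e' ∘ e.symm) =ᶠ[nhds (e p)] e.symm := by
  have h : ∀ᶠ y in nhds (e p), e.symm y ∈ e'.source := by
    refine (e.continuousAt_symm (e.map_source hp)).eventually_mem ?_
    rw [e.left_inv hp]
    exact e'.open_source.mem_nhds hp'
  filter_upwards [h] with y hy
  exact e'.left_inv hy

omit [IsManifold 𝓘(ℝ, Model m) ∞ M] in
theorem mfderiv_symm_apply {y : Model m} (hy : y = e p) (v : Model m) :
    (mfderiv 𝓘(ℝ, Model m) 𝓘(ℝ, Model m) e.symm y v : Model m)
      = ∑ k, v k • tangentFrame e p k := by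
  subst hy
  conv_lhs => rw [sum_smul_frame v]
  erw [map_sum]
  refine Finset.sum_congr rfl fun k _ ↦ ?_
  erw [map_smul]
  rfl

/-- The chain rule for `e.symm = e'.symm ∘ (e' ∘ e.symm)`, valid near `e p`. -/
theorem tangentFrame_eq_sum (he : e ∈ atlas (Model m) M) (he' : e' ∈ atlas (Model m) M)
    (hp : p ∈ e.source) (hp' : p ∈ e'.source) (i : Fin m) :
    tangentFrame e p i = ∑ k, jacobian e e' p k i • tangentFrame e' p k := by
  have hq : (e' ∘ e.symm) (e p) = e' p := congrArg e' (e.left_inv hp)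
  have h1 : MDifferentiableAt 𝓘(ℝ, Model m) 𝓘(ℝ, Model m) (e' ∘ e.symm) (e p) :=
    ((contDiffAt_transition he he' hp hp').differentiableAt (by simp)).mdifferentiableAt
  have h2 : MDifferentiableAt 𝓘(ℝ, Model m) 𝓘(ℝ, Model m) e'.symm (e' p) :=
    mdifferentiableAt_atlas_symm he' (e'.map_source hp')
  have h3 : HasMFDerivAt 𝓘(ℝ, Model m) 𝓘(ℝ, Model m) e.symm (e p)
      ((mfderiv 𝓘(ℝ, Model m) 𝓘(ℝ, Model m) e'.symm ((e' ∘ e.symm) (e p))).comp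
        (mfderiv 𝓘(ℝ, Model m) 𝓘(ℝ, Model m) (e' ∘ e.symm) (e p))) :=
    (HasMFDerivAt.comp (e p) (by rw [hq]; exact h2.hasMFDerivAt) h1.hasMFDerivAt).congr_of_eventuallyEq
      (symm_eventuallyEq hp hp').symm
  have h5 := congrArg (fun L : Model m →L[ℝ] Model m ↦ L (frame m i)) h3.mfderiv
  refine Eq.trans h5 ((mfderiv_symm_apply hq _).trans ?_)
  rw [mfderiv_eq_fderiv]
  rfl

theorem metricMatrix_eq (g : SmoothMetric m M) (he : e ∈ atlas (Model m) M)
    (he' : e' ∈ atlas (Model m) M) (hp : p ∈ e.source) (hp' : p ∈ e'.source) :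
    metricMatrix g e (e p)
      = (jacobian e e' p).transpose * metricMatrix g e' (e' p) * jacobian e e' p := by
  ext i j
  rw [metricMatrix_chart g hp, tangentFrame_eq_sum he he' hp hp' i,
    tangentFrame_eq_sum he he' hp hp' j]
  simp only [map_sum, map_smul, Matrix.mul_apply, Matrix.transpose_apply, metricMatrix_chart g hp',
    Finset.sum_mul, Finset.mul_sum, FunLike.coe_sum, Finset.sum_apply, FunLike.coe_smul,
    Pi.smul_apply, smul_eq_mul]
  exact Finset.sum_congr rfl fun k _ ↦ Finset.sum_congr rfl fun l _ ↦ by ring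

theorem metricMatrix_symm (g : SmoothMetric m M) (y : Model m) (i j : Fin m) :
    metricMatrix g e y i j = metricMatrix g e y j i :=
  g.symm _ _ _

/-- The matrix is the Gram matrix of a frame, which is linearly independent because the derivative
of `e.symm` is injective. -/
theorem metricMatrix_det_pos (g : SmoothMetric m M) (he : e ∈ atlas (Model m) M)
    (hp : p ∈ e.source) : 0 < (metricMatrix g e (e p)).det := by
  refine (Matrix.PosDef.of_dotProduct_mulVec_pos ?_ ?_).det_pos
  · ext i j
    exact metricMatrix_symm g _ _ _
  · intro x hx
    have h1 : star x ⬝ᵥ (metricMatrix g e (e p)).mulVec x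
        = innerAt g p (∑ i, x i • tangentFrame e p i) (∑ i, x i • tangentFrame e p i) := by
      simp only [dotProduct, Matrix.mulVec, metricMatrix_chart g hp, map_sum, map_smul,
        FunLike.coe_sum, Finset.sum_apply, FunLike.coe_smul, Pi.smul_apply, smul_eq_mul,
        Finset.mul_sum, star_trivial, Pi.star_apply]
      rw [Finset.sum_comm]
      exact Finset.sum_congr rfl fun k _ ↦ Finset.sum_congr rfl fun l _ ↦ by ring
    rw [h1]
    refine g.pos p _ fun h0 ↦ hx ?_
    have hinj : Function.Injective
        (mfderiv 𝓘(ℝ, Model m) 𝓘(ℝ, Model m) e.symm (e p)) :=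
      (mdifferentiable_of_mem_atlas he).symm.mfderiv_injective (e.map_source hp)
    have h2 := mfderiv_symm_apply (e := e) (p := p) rfl (WithLp.toLp 2 x)
    have h3 : (WithLp.toLp 2 x : Model m) = 0 := hinj ((h2.trans h0).trans (map_zero _).symm)
    simpa using h3

/-- Read off from any metric: a singular Jacobian would make the Gram determinant vanish by the
transformation law. -/
theorem jacobian_det_ne_zero [Nonempty (SmoothMetric m M)] (he : e ∈ atlas (Model m) M)
    (he' : e' ∈ atlas (Model m) M) (hp : p ∈ e.source) (hp' : p ∈ e'.source) :
    (jacobian e e' p).det ≠ 0 := by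
  obtain ⟨g⟩ := ‹Nonempty (SmoothMetric m M)›
  intro h
  have := metricMatrix_det_pos g he hp
  rw [metricMatrix_eq g he he' hp hp', Matrix.det_mul, h, mul_zero] at this
  exact this.false

theorem sqrt_det_metricMatrix (g : SmoothMetric m M) (he : e ∈ atlas (Model m) M)
    (he' : e' ∈ atlas (Model m) M) (hp : p ∈ e.source) (hp' : p ∈ e'.source) :
    √(metricMatrix g e (e p)).det = |(jacobian e e' p).det| * √(metricMatrix g e' (e' p)).det := by
  rw [metricMatrix_eq g he he' hp hp', Matrix.det_mul, Matrix.det_mul, Matrix.det_transpose,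
    mul_right_comm, Real.sqrt_mul (mul_self_nonneg _), Real.sqrt_mul_self_eq_abs]

omit [ChartedSpace (Model m) M] [IsManifold 𝓘(ℝ, Model m) ∞ M] in
theorem jacobian_det (e e' : OpenPartialHomeomorph M (Model m)) (p : M) :
    (jacobian e e' p).det = (fderiv ℝ (e' ∘ e.symm) (e p)).det := by
  rw [ContinuousLinearMap.det, ← LinearMap.det_toMatrix (EuclideanSpace.basisFun (Fin m) ℝ).toBasis]
  congr 1

end ChangeOfChart

end Foliation

namespace CoordGeom

/-! ### From the slab to its time slices. -/

section Slice

variable {E : Type*} [NormedAddCommGroup E] [NormedSpace ℝ E] {U : Set E} {t₀ t : ℝ} {y : E}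
  {F : E × ℝ → ℝ} {ι : Type*} [Fintype ι] [DecidableEq ι] {G : E × ℝ → Matrix ι ι ℝ}

theorem uniqueDiffOn_slab (hU : IsOpen U) (ht₀ : 0 < t₀) : UniqueDiffOn ℝ (U ×ˢ Icc 0 t₀) :=
  hU.uniqueDiffOn.prod (uniqueDiffOn_Icc ht₀)

theorem hasDerivWithinAt_slab (hF : DifferentiableOn ℝ F (U ×ˢ Icc 0 t₀)) (hy : y ∈ U)
    (ht : t ∈ Icc 0 t₀) :
    HasDerivWithinAt (fun s ↦ F (y, s)) (pderiv (U ×ˢ Icc 0 t₀) (0, 1) F (y, t)) (Icc 0 t₀) t := by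
  have h1 : HasDerivWithinAt (fun s : ℝ ↦ (y, s)) (0, 1) (Icc 0 t₀) t :=
    ((hasDerivAt_const t y).prodMk (hasDerivAt_id t)).hasDerivWithinAt
  exact (hF (y, t) ⟨hy, ht⟩).hasFDerivWithinAt.comp_hasDerivWithinAt t h1 fun s hs ↦ ⟨hy, hs⟩

theorem hasFDerivAt_slab (hU : IsOpen U) (hF : DifferentiableOn ℝ F (U ×ˢ Icc 0 t₀)) (hy : y ∈ U)
    (ht : t ∈ Icc 0 t₀) :
    HasFDerivAt (fun y ↦ F (y, t))
      ((fderivWithin ℝ F (U ×ˢ Icc 0 t₀) (y, t)).comp (ContinuousLinearMap.inl ℝ E ℝ)) y := by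
  have h1 : HasFDerivWithinAt (fun y : E ↦ (y, t)) (ContinuousLinearMap.inl ℝ E ℝ) U y :=
    ((hasFDerivAt_id y).prodMk (hasFDerivAt_const t y)).hasFDerivWithinAt
  have h2 : MapsTo (fun y : E ↦ (y, t)) U (U ×ˢ Icc 0 t₀) := fun w hw ↦ ⟨hw, ht⟩
  exact ((hF (y, t) ⟨hy, ht⟩).hasFDerivWithinAt.comp y h1 h2).hasFDerivAt (hU.mem_nhds hy)

theorem fderiv_slab (hU : IsOpen U) (hF : DifferentiableOn ℝ F (U ×ˢ Icc 0 t₀)) (hy : y ∈ U)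
    (ht : t ∈ Icc 0 t₀) (v : E) :
    fderiv ℝ (fun y ↦ F (y, t)) y v = pderiv (U ×ˢ Icc 0 t₀) (v, 0) F (y, t) := by
  rw [(hasFDerivAt_slab hU hF hy ht).fderiv]
  rfl

theorem pderiv_slab (hU : IsOpen U) (hF : DifferentiableOn ℝ F (U ×ˢ Icc 0 t₀)) (hy : y ∈ U)
    (ht : t ∈ Icc 0 t₀) (v : E) :
    pderiv U v (fun y ↦ F (y, t)) y = pderiv (U ×ˢ Icc 0 t₀) (v, 0) F (y, t) := by
  rw [← fderiv_slab hU hF hy ht, pderiv, fderivWithin_of_isOpen hU hy]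

theorem contDiffOn_slice {n : WithTop ℕ∞} (hF : ContDiffOn ℝ n F (U ×ˢ Icc 0 t₀))
    (ht : t ∈ Icc 0 t₀) : ContDiffOn ℝ n (fun y ↦ F (y, t)) U :=
  hF.comp (contDiffOn_id.prodMk contDiffOn_const) fun _ hy ↦ ⟨hy, ht⟩

omit [NormedSpace ℝ E] in
theorem continuousOn_slice (hF : ContinuousOn F (U ×ˢ Icc 0 t₀))
    (ht : t ∈ Icc 0 t₀) : ContinuousOn (fun y ↦ F (y, t)) U :=
  hF.comp (continuousOn_id.prodMk continuousOn_const) fun _ hy ↦ ⟨hy, ht⟩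

variable (b : ι → E)

theorem christoffel_slab (hU : IsOpen U) (hG : IsMetricOn (U ×ˢ Icc 0 t₀) G) (hy : y ∈ U)
    (ht : t ∈ Icc 0 t₀) (k i j : ι) :
    christoffel U b (fun y ↦ G (y, t)) k i j y
      = christoffel (U ×ˢ Icc 0 t₀) (fun i ↦ (b i, (0 : ℝ))) G k i j (y, t) := by
  have h : ∀ v i j, pderiv U v (fun y ↦ G (y, t) i j) y
      = pderiv (U ×ˢ Icc 0 t₀) (v, 0) (fun z ↦ G z i j) (y, t) := fun v i j ↦
    pderiv_slab hU (hG.smooth i j).differentiableOn_infty hy ht v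
  simp only [christoffel, h]

/-- Spatial derivatives are the same whether `t` is frozen or not. This identifies the intrinsic
curvature of a leaf with the leaf term in `scalarCurv_warped`. -/
theorem scalarCurv_slab (hU : IsOpen U) (ht₀ : 0 < t₀) (hG : IsMetricOn (U ×ˢ Icc 0 t₀) G)
    (hy : y ∈ U) (ht : t ∈ Icc 0 t₀) :
    scalarCurv U b (fun y ↦ G (y, t)) y
      = scalarCurv (U ×ˢ Icc 0 t₀) (fun i ↦ (b i, (0 : ℝ))) G (y, t) := by
  have h : ∀ v k i j, pderiv U v (christoffel U b (fun y ↦ G (y, t)) k i j) y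
      = pderiv (U ×ˢ Icc 0 t₀) (v, 0)
        (christoffel (U ×ˢ Icc 0 t₀) (fun i ↦ (b i, (0 : ℝ))) G k i j) (y, t) := by
    intro v k i j
    rw [← pderiv_slab hU (contDiffOn_christoffel hG (uniqueDiffOn_slab hU ht₀) _ k i
      j).differentiableOn_infty hy ht]
    exact pderiv_congr (fun w hw ↦ christoffel_slab b hU hG hw ht k i j) hy
  simp only [scalarCurv, ricci, riemann, h, christoffel_slab b hU hG hy ht]

end Slice

/-! ### The mean curvature of the leaves for a general lapse. -/

section MeanCurvature

variable {V : Type*} [NormedAddCommGroup V] [NormedSpace ℝ V] {S : Set V}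
  {ι : Type*} [Fintype ι] [DecidableEq ι] {z : V} {G : V → Matrix ι ι ℝ} {φ : V → ℝ}

/-- The trace of the second fundamental form of the leaves of a warped metric. -/
theorem trace_covDeriv_normal (b : ι ⊕ Unit → V) (hG : IsMetricOn S G) (hz : z ∈ S)
    (h0 : φ z ≠ 0) :
    ∑ i, ∑ j, (G z)⁻¹ i j * ∑ a, covDeriv S b (warped G φ) (.inl i)
        (Sum.elim (fun _ _ ↦ 0) (fun _ z ↦ (φ z)⁻¹)) a z * warped G φ z a (.inl j)
      = leafH S (b (.inr ())) G z / φ z := by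
  have h1 : ∀ i j, ∑ a, covDeriv S b (warped G φ) (.inl i)
        (Sum.elim (fun _ _ ↦ 0) (fun _ z ↦ (φ z)⁻¹)) a z * warped G φ z a (.inl j)
      = 1 / 2 * (φ z)⁻¹ * ∑ k, shape S (b (.inr ())) G z k i * G z k j := by
    intro i j
    simp only [covDeriv, Fintype.sum_sum_type, Finset.univ_unique, Finset.sum_singleton,
      PUnit.default_eq_unit, christoffel_warped_sst b (hG.det_ne z hz) h0,
      sum_inv_mul_pderiv hG hz, Sum.elim_inl, Sum.elim_inr, mul_zero, Finset.sum_const_zero,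
      zero_add, warped, Matrix.fromBlocks_apply₁₁, Matrix.fromBlocks_apply₂₁, Matrix.zero_apply,
      add_zero, Finset.mul_sum]
    refine Finset.sum_congr rfl fun k _ ↦ ?_
    rw [show pderiv S (b (.inl i)) (fun _ ↦ (0 : ℝ)) z = 0 from pderiv_const 0]
    ring
  have h2 : ∀ i, ∑ j, (G z)⁻¹ i j * ∑ k, shape S (b (.inr ())) G z k i * G z k j
      = shape S (b (.inr ())) G z i i := by
    intro i
    have h3 : ∀ k, ∑ j, (G z)⁻¹ i j * G z j k = (1 : Matrix ι ι ℝ) i k := fun k ↦ by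
      rw [← Matrix.nonsing_inv_mul _ (isUnit_iff_ne_zero.2 (hG.det_ne z hz))]
      rfl
    simp only [Finset.mul_sum]
    rw [Finset.sum_comm]
    trans ∑ k, shape S (b (.inr ())) G z k i * (1 : Matrix ι ι ℝ) i k
    · refine Finset.sum_congr rfl fun k _ ↦ ?_
      rw [← h3, Finset.mul_sum]
      exact Finset.sum_congr rfl fun j _ ↦ by rw [hG.symm z hz k j]; ring
    · simp [Matrix.one_apply]
  have h4 : ∀ i, ∑ j, (G z)⁻¹ i j
      * (1 / 2 * (φ z)⁻¹ * ∑ k, shape S (b (.inr ())) G z k i * G z k j)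
      = 1 / 2 * (φ z)⁻¹ * shape S (b (.inr ())) G z i i := fun i ↦ by
    rw [← h2, Finset.mul_sum]
    exact Finset.sum_congr rfl fun j _ ↦ by ring
  simp only [h1, h4, leafH, Matrix.trace, Matrix.diag, ← Finset.mul_sum]
  ring

end MeanCurvature

end CoordGeom

namespace Foliation

open CoordGeom

/-! ### Curvature identities for the family `g_t` in a chart. -/

section SlabGeometry

variable {m : ℕ} {M : Type*} [TopologicalSpace M] [ChartedSpace (Model m) M]
  [IsManifold 𝓘(ℝ, Model m) ∞ M] {e e' : OpenPartialHomeomorph M (Model m)} {p : M}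
  {t₀ t : ℝ} {g : ℝ → SmoothMetric m M} {f : M × ℝ → ℝ} {z : Model m × ℝ} {y : Model m}

/-- The components of the family `g_t` in the chart `e`, as functions on the slab. -/
def famMatrix (g : ℝ → SmoothMetric m M) (e : OpenPartialHomeomorph M (Model m))
    (z : Model m × ℝ) : Matrix (Fin m) (Fin m) ℝ :=
  metricMatrix (g z.2) e z.1

/-- The function `f` in the coordinates of the chart `e`. -/
def inChart (f : M × ℝ → ℝ) (e : OpenPartialHomeomorph M (Model m)) (z : Model m × ℝ) : ℝ :=
  f (e.symm z.1, z.2)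

/-- The mean curvature of the leaves for the lapse function `1`, in the chart `e`. -/
def slabH (t₀ : ℝ) (g : ℝ → SmoothMetric m M) (e : OpenPartialHomeomorph M (Model m)) :
    Model m × ℝ → ℝ :=
  leafH (slab t₀ e) (0, 1) (famMatrix g e)

/-- The squared norm of the second fundamental form for the lapse function `1`, in the chart
`e`. -/
def slabSq (t₀ : ℝ) (g : ℝ → SmoothMetric m M) (e : OpenPartialHomeomorph M (Model m)) :
    Model m × ℝ → ℝ :=
  leafSq (slab t₀ e) (0, 1) (famMatrix g e)

/-- The coordinate frame of the leaves on the slab. -/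
def leafFrame (m : ℕ) (i : Fin m) : Model m × ℝ := (frame m i, 0)

omit [ChartedSpace (Model m) M] [IsManifold 𝓘(ℝ, Model m) ∞ M] in
theorem uniqueDiffOn_slab' (ht₀ : 0 < t₀) (e : OpenPartialHomeomorph M (Model m)) :
    UniqueDiffOn ℝ (slab t₀ e) :=
  uniqueDiffOn_slab e.open_target ht₀

theorem SmoothFamily.isMetricOn (hg : SmoothFamily t₀ g) (he : e ∈ atlas (Model m) M) :
    IsMetricOn (slab t₀ e) (famMatrix g e) where
  smooth := hg e he
  symm z _ i j := metricMatrix_symm _ _ i j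
  det_pos z hz := by
    have := metricMatrix_det_pos (g z.2) he (e.map_target hz.1)
    rwa [e.right_inv hz.1] at this

theorem SmoothOnSlab.inChart (hf : SmoothOnSlab (m := m) t₀ f) (he : e ∈ atlas (Model m) M) :
    ContDiffOn ℝ ∞ (inChart f e) (slab t₀ e) := by
  rw [← contMDiffOn_iff_contDiffOn]
  refine ContMDiffOn.comp (I' := 𝓘(ℝ, Model m).prod 𝓘(ℝ, ℝ)) hf ?_ fun z hz ↦ ⟨mem_univ _, hz.2⟩
  refine ContMDiffOn.prodMk ?_ contDiff_snd.contDiffOn.contMDiffOn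
  exact (contMDiffOn_symm_of_mem_maximalAtlas (IsManifold.subset_maximalAtlas he)).comp
    contDiff_fst.contDiffOn.contMDiffOn fun z hz ↦ hz.1

theorem slabMatrix_eq (g : ℝ → SmoothMetric m M) (f : M × ℝ → ℝ)
    (e : OpenPartialHomeomorph M (Model m)) :
    slabMatrix g f e = warped (famMatrix g e) (inChart f e) := rfl

theorem contDiffOn_slabH (ht₀ : 0 < t₀) (hg : SmoothFamily t₀ g) (he : e ∈ atlas (Model m) M) :
    ContDiffOn ℝ ∞ (slabH t₀ g e) (slab t₀ e) :=
  contDiffOn_leafH (hg.isMetricOn he) (uniqueDiffOn_slab' ht₀ e) _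

theorem contDiffOn_slabSq (ht₀ : 0 < t₀) (hg : SmoothFamily t₀ g) (he : e ∈ atlas (Model m) M) :
    ContDiffOn ℝ ∞ (slabSq t₀ g e) (slab t₀ e) :=
  contDiffOn_leafSq (hg.isMetricOn he) (uniqueDiffOn_slab' ht₀ e) _

theorem trace_secondFundamentalForm (hg : SmoothFamily t₀ g) (he : e ∈ atlas (Model m) M)
    (hz : z ∈ slab t₀ e) (h0 : inChart f e z ≠ 0) :
    ∑ i, ∑ j, (famMatrix g e z)⁻¹ i j * secondFundamentalForm t₀ g f e i j z
      = slabH t₀ g e z / inChart f e z :=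
  trace_covDeriv_normal (slabFrame m) (hg.isMetricOn he) hz h0

/-- The symbols `Γ^k_{it}` do not depend on the lapse, so `f` enters only through the normal `f⁻¹
∂_t`. Its derivative contributes only to the normal component of `∇ν`, which the tangential pairing
discards. -/
theorem meanCurvature_eq (hg : SmoothFamily t₀ g) (ht : t ∈ Icc 0 t₀) (h0 : f (p, t) ≠ 0) :
    meanCurvature t₀ g f t p
      = slabH t₀ g (chartAt (Model m) p) (chartAt (Model m) p p, t) / f (p, t) := by
  have h1 : inChart f (chartAt (Model m) p) (chartAt (Model m) p p, t) = f (p, t) := by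
    simp [inChart]
  have h := trace_secondFundamentalForm (f := f) hg (chart_mem_atlas (Model m) p)
    (z := (chartAt (Model m) p p, t)) ⟨mem_chart_target _ p, ht⟩ (by rwa [h1])
  rwa [h1] at h

/-- The scalar curvature of the leaf, in the chart `e`. -/
def leafScal (t₀ : ℝ) (g : ℝ → SmoothMetric m M) (e : OpenPartialHomeomorph M (Model m)) :
    Model m × ℝ → ℝ :=
  scalarCurv (slab t₀ e) (leafFrame m) (famMatrix g e)

theorem scalarCurvature_eq (ht₀ : 0 < t₀) (hg : SmoothFamily t₀ g) (ht : t ∈ Icc 0 t₀) :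
    scalarCurvature (g t) p
      = leafScal t₀ g (chartAt (Model m) p) (chartAt (Model m) p p, t) := by
  have h := scalarCurv_slab (G := famMatrix g (chartAt (Model m) p)) (frame m)
    (chartAt (Model m) p).open_target ht₀ (hg.isMetricOn (chart_mem_atlas (Model m) p))
    (mem_chart_target _ p) ht
  unfold scalarCurvature leafScal
  exact h

theorem RicciFlat.scalarFlat (h : RicciFlat t₀ g f) : ScalarFlat t₀ g f := by
  intro e he z hz
  simp only [scalarCurv, h e he z hz, mul_zero, Finset.sum_const_zero]

/-- The Gauss equation with both ambient terms zero. It turns `H² - |h|²` into `2 K η²`, whatever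
the other lapse is. -/
theorem RicciFlat.leafScal_eq (h : RicciFlat t₀ g f) (ht₀ : 0 < t₀) (hg : SmoothFamily t₀ g)
    (hf : SmoothOnSlab (m := m) t₀ f) (hpos : ∀ p : M, ∀ t ∈ Icc 0 t₀, 0 < f (p, t))
    (he : e ∈ atlas (Model m) M) (hz : z ∈ slab t₀ e) :
    leafScal t₀ g e z = (slabH t₀ g e z ^ 2 - slabSq t₀ g e z) / inChart f e z ^ 2 := by
  have h1 := scalarCurv_warped (slabFrame m) (hg.isMetricOn he) (uniqueDiffOn_slab' ht₀ e) hz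
    (hf.inChart he) fun w hw ↦ (hpos _ _ hw.2).ne'
  rw [← slabMatrix_eq, h.scalarFlat e he z hz, h e he z hz] at h1
  have h2 : inChart f e z ≠ 0 := (hpos _ _ hz.2).ne'
  change 0 = leafScal t₀ g e z + (slabSq t₀ g e z - slabH t₀ g e z ^ 2) * _ + _ at h1
  field_simp at h1 ⊢
  linarith

/-- The evolution of the mean curvature when the metric `g_f` is scalar flat. -/
theorem ScalarFlat.pderiv_meanCurvature (h : ScalarFlat t₀ g f) (ht₀ : 0 < t₀)
    (hg : SmoothFamily t₀ g) (hf : SmoothOnSlab (m := m) t₀ f)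
    (hpos : ∀ p : M, ∀ t ∈ Icc 0 t₀, 0 < f (p, t)) (he : e ∈ atlas (Model m) M)
    (hz : z ∈ slab t₀ e) :
    pderiv (slab t₀ e) (0, 1) (fun z ↦ slabH t₀ g e z / inChart f e z) z
        + slabH t₀ g e z / inChart f e z * slabH t₀ g e z
      = inChart f e z * leafScal t₀ g e z / 2
        + (slabH t₀ g e z ^ 2 - slabSq t₀ g e z) / (2 * inChart f e z)
        - laplacian (slab t₀ e) (leafFrame m) (famMatrix g e) (inChart f e) z := by
  have hS := uniqueDiffOn_slab' ht₀ e
  have h0 : ∀ w ∈ slab t₀ e, inChart f e w ≠ 0 := fun w hw ↦ (hpos _ _ hw.2).ne'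
  have hf' := hf.inChart he
  have h1 := scalarCurv_warped (slabFrame m) (hg.isMetricOn he) hS hz hf' h0
  rw [← slabMatrix_eq, h e he z hz, slabMatrix_eq,
    ricci_warped_tt _ (hg.isMetricOn he) hS hz hf' h0] at h1
  change 0 = leafScal t₀ g e z + (slabSq t₀ g e z - slabH t₀ g e z ^ 2) * _
    + 2 * ((-(_ * laplacian (slab t₀ e) (leafFrame m) (famMatrix g e) (inChart f e) z)
      - pderiv (slab t₀ e) (0, 1) (slabH t₀ g e) z
      + slabH t₀ g e z * (pderiv (slab t₀ e) (0, 1) (inChart f e) z * _)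
      - slabSq t₀ g e z) * _) at h1
  have h2 : pderiv (slab t₀ e) (0, 1) (fun z ↦ slabH t₀ g e z / inChart f e z) z
      = pderiv (slab t₀ e) (0, 1) (slabH t₀ g e) z * (inChart f e z)⁻¹
        + slabH t₀ g e z * (-pderiv (slab t₀ e) (0, 1) (inChart f e) z / inChart f e z ^ 2) := by
    simp only [div_eq_mul_inv (slabH t₀ g e _)]
    rw [pderiv_mul (F' := fun z ↦ (inChart f e z)⁻¹) hS hz (contDiffOn_slabH ht₀ hg he).differentiableOn_infty
      (hf'.inv h0).differentiableOn_infty, pderiv_inv hS hz hf'.differentiableOn_infty h0]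
  rw [h2]
  have h3 := h0 z hz
  field_simp at h1 ⊢
  linarith

end SlabGeometry

/-! ### Chart independence of the extrinsic quantities and of gradient pairings. -/

section Invariance

variable {m : ℕ} {M : Type*} [TopologicalSpace M] [ChartedSpace (Model m) M]
  [IsManifold 𝓘(ℝ, Model m) ∞ M] {e e' : OpenPartialHomeomorph M (Model m)} {p : M}
  {t₀ t : ℝ} {g : ℝ → SmoothMetric m M} {f : M × ℝ → ℝ}

/-- The Jacobian does not depend on `t`, so `∂_t g` transforms like `g` itself. -/
theorem matDeriv_famMatrix (ht₀ : 0 < t₀) (hg : SmoothFamily t₀ g) (he : e ∈ atlas (Model m) M)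
    (he' : e' ∈ atlas (Model m) M) (hp : p ∈ e.source) (hp' : p ∈ e'.source) (ht : t ∈ Icc 0 t₀) :
    matDeriv (slab t₀ e) (0, 1) (famMatrix g e) (e p, t)
      = (jacobian e e' p).transpose * matDeriv (slab t₀ e') (0, 1) (famMatrix g e') (e' p, t)
        * jacobian e e' p := by
  ext i j
  have h1 := hasDerivWithinAt_slab (hg e he i j).differentiableOn_infty (e.map_source hp) ht
  have h2 : ∀ k l, HasDerivWithinAt (fun s ↦ famMatrix g e' (e' p, s) k l)
      (matDeriv (slab t₀ e') (0, 1) (famMatrix g e') (e' p, t) k l) (Icc 0 t₀) t := fun k l ↦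
    hasDerivWithinAt_slab (hg e' he' k l).differentiableOn_infty (e'.map_source hp') ht
  have h3 : HasDerivWithinAt (fun s ↦ ∑ l, (∑ k, jacobian e e' p k i
        * famMatrix g e' (e' p, s) k l) * jacobian e e' p l j)
      (∑ l, (∑ k, jacobian e e' p k i * matDeriv (slab t₀ e') (0, 1) (famMatrix g e') (e' p, t) k l)
        * jacobian e e' p l j) (Icc 0 t₀) t :=
    HasDerivWithinAt.fun_sum fun l _ ↦ (HasDerivWithinAt.fun_sum fun k _ ↦
      (h2 k l).const_mul _).mul_const _
  have h4 : (fun s ↦ metricMatrix (g s) e (e p) i j) = fun s ↦ ∑ l, (∑ k, jacobian e e' p k i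
        * famMatrix g e' (e' p, s) k l) * jacobian e e' p l j := by
    funext s
    rw [metricMatrix_eq (g s) he he' hp hp']
    rfl
  exact (uniqueDiffOn_Icc ht₀ t ht).eq_deriv _ (h4 ▸ h1) h3

theorem famMatrix_eq (he : e ∈ atlas (Model m) M)
    (he' : e' ∈ atlas (Model m) M) (hp : p ∈ e.source) (hp' : p ∈ e'.source) :
    famMatrix g e (e p, t)
      = (jacobian e e' p).transpose * famMatrix g e' (e' p, t) * jacobian e e' p :=
  metricMatrix_eq (g t) he he' hp hp'

/-- A change of chart conjugates this endomorphism, so the traces of it and of its square are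
invariant. -/
theorem shape_famMatrix (ht₀ : 0 < t₀) (hg : SmoothFamily t₀ g) (he : e ∈ atlas (Model m) M)
    (he' : e' ∈ atlas (Model m) M) (hp : p ∈ e.source) (hp' : p ∈ e'.source) (ht : t ∈ Icc 0 t₀) :
    shape (slab t₀ e) (0, 1) (famMatrix g e) (e p, t)
      = (jacobian e e' p)⁻¹ * shape (slab t₀ e') (0, 1) (famMatrix g e') (e' p, t)
        * jacobian e e' p := by
  have : Nonempty (SmoothMetric m M) := ⟨g 0⟩
  have hJ : IsUnit (jacobian e e' p).transpose.det := by
    rw [Matrix.det_transpose]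
    exact isUnit_iff_ne_zero.2 (jacobian_det_ne_zero he he' hp hp')
  rw [shape, matDeriv_famMatrix ht₀ hg he he' hp hp' ht, famMatrix_eq he he' hp hp',
    Matrix.mul_inv_rev, Matrix.mul_inv_rev, shape]
  simp only [Matrix.mul_assoc, Matrix.nonsing_inv_mul_cancel_left _ _ hJ]

theorem slabH_eq (ht₀ : 0 < t₀) (hg : SmoothFamily t₀ g) (he : e ∈ atlas (Model m) M)
    (he' : e' ∈ atlas (Model m) M) (hp : p ∈ e.source) (hp' : p ∈ e'.source) (ht : t ∈ Icc 0 t₀) :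
    slabH t₀ g e (e p, t) = slabH t₀ g e' (e' p, t) := by
  have : Nonempty (SmoothMetric m M) := ⟨g 0⟩
  have hJ := isUnit_iff_ne_zero.2 (jacobian_det_ne_zero he he' hp hp')
  rw [slabH, leafH, shape_famMatrix ht₀ hg he he' hp hp' ht, Matrix.trace_mul_comm,
    Matrix.mul_nonsing_inv_cancel_left _ _ hJ]
  rfl

theorem slabSq_eq (ht₀ : 0 < t₀) (hg : SmoothFamily t₀ g) (he : e ∈ atlas (Model m) M)
    (he' : e' ∈ atlas (Model m) M) (hp : p ∈ e.source) (hp' : p ∈ e'.source) (ht : t ∈ Icc 0 t₀) :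
    slabSq t₀ g e (e p, t) = slabSq t₀ g e' (e' p, t) := by
  have : Nonempty (SmoothMetric m M) := ⟨g 0⟩
  have hJ := isUnit_iff_ne_zero.2 (jacobian_det_ne_zero he he' hp hp')
  rw [slabSq, leafSq, shape_famMatrix ht₀ hg he he' hp hp' ht]
  simp only [Matrix.mul_assoc, Matrix.mul_nonsing_inv_cancel_left _ _ hJ]
  rw [Matrix.trace_mul_comm]
  simp only [Matrix.mul_assoc, Matrix.mul_nonsing_inv _ hJ, Matrix.mul_one]
  rfl

/-- The partial derivatives of `q` at `p` in the coordinates of the chart `e`. -/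
def chartDeriv (e : OpenPartialHomeomorph M (Model m)) (q : M → ℝ) (p : M) (i : Fin m) : ℝ :=
  fderiv ℝ (q ∘ e.symm) (e p) (frame m i)

theorem chartDeriv_eq {q : M → ℝ} (he : e ∈ atlas (Model m) M)
    (he' : e' ∈ atlas (Model m) M) (hp : p ∈ e.source) (hp' : p ∈ e'.source)
    (hq : DifferentiableAt ℝ (q ∘ e'.symm) (e' p)) :
    chartDeriv e q p = (jacobian e e' p).transpose.mulVec (chartDeriv e' q p) := by
  have h1 : (e' ∘ e.symm) (e p) = e' p := congrArg e' (e.left_inv hp)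
  have h2 : (q ∘ e'.symm) ∘ (e' ∘ e.symm) =ᶠ[nhds (e p)] q ∘ e.symm :=
    (symm_eventuallyEq hp hp').fun_comp q
  ext i
  rw [chartDeriv, ← h2.fderiv_eq, fderiv_comp _ (by rwa [h1])
    ((contDiffAt_transition he he' hp hp').differentiableAt (by simp)), h1,
    ContinuousLinearMap.comp_apply, sum_smul_frame (fderiv ℝ (e' ∘ e.symm) (e p) (frame m i)),
    map_sum]
  simp only [map_smul, smul_eq_mul]
  rfl

/-- The inner product of the gradients of `q` and `r`, computed in the chart `e`. -/
def gradPairing (g : SmoothMetric m M) (e : OpenPartialHomeomorph M (Model m)) (q r : M → ℝ)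
    (p : M) : ℝ :=
  chartDeriv e q p ⬝ᵥ ((metricMatrix g e (e p))⁻¹.mulVec (chartDeriv e r p))

theorem gradPairing_eq (g : SmoothMetric m M) {q r : M → ℝ} (he : e ∈ atlas (Model m) M)
    (he' : e' ∈ atlas (Model m) M) (hp : p ∈ e.source) (hp' : p ∈ e'.source)
    (hq : DifferentiableAt ℝ (q ∘ e'.symm) (e' p)) (hr : DifferentiableAt ℝ (r ∘ e'.symm) (e' p)) :
    gradPairing g e q r p = gradPairing g e' q r p := by
  have : Nonempty (SmoothMetric m M) := ⟨g⟩
  have hJ := isUnit_iff_ne_zero.2 (jacobian_det_ne_zero he he' hp hp')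
  have hJ' : IsUnit (jacobian e e' p).transpose.det := by rwa [Matrix.det_transpose]
  rw [gradPairing, chartDeriv_eq he he' hp hp' hq, chartDeriv_eq he he' hp hp' hr,
    metricMatrix_eq g he he' hp hp', Matrix.mulVec_mulVec, Matrix.mul_inv_rev, Matrix.mul_inv_rev,
    Matrix.mul_assoc, Matrix.mul_assoc, Matrix.nonsing_inv_mul _ hJ', Matrix.mul_one,
    Matrix.mulVec_transpose, ← Matrix.dotProduct_mulVec, Matrix.mulVec_mulVec,
    Matrix.mul_nonsing_inv_cancel_left _ _ hJ]
  rfl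

end Invariance

/-! ### The Riemannian volume measure in a chart. -/

section Volume

variable {m : ℕ} {M : Type*} [TopologicalSpace M] [ChartedSpace (Model m) M]
  [IsManifold 𝓘(ℝ, Model m) ∞ M] [MeasurableSpace M] [BorelSpace M]
  {e e' : OpenPartialHomeomorph M (Model m)} {g : SmoothMetric m M}

/-- The density of the Riemannian volume in the chart `e`. -/
def density (g : SmoothMetric m M) (e : OpenPartialHomeomorph M (Model m)) (y : Model m) : ℝ :=
  √(metricMatrix g e y).det

omit [ChartedSpace (Model m) M] [IsManifold 𝓘(ℝ, Model m) ∞ M] in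
theorem measurableSet_target_inter_preimage (e : OpenPartialHomeomorph M (Model m)) {A : Set M}
    (hA : MeasurableSet A) : MeasurableSet (e.target ∩ e.symm ⁻¹' A) := by
  have h1 : Measurable (e.target.domRestrict e.symm) :=
    (continuousOn_iff_continuous_domRestrict.1 e.continuousOn_symm).measurable
  have h2 := e.open_target.measurableSet.subtype_image (h1 hA)
  convert h2 using 1
  ext y
  simp [Set.domRestrict_apply, and_comm]

omit [ChartedSpace (Model m) M] [IsManifold 𝓘(ℝ, Model m) ∞ M] in
theorem aemeasurable_symm (e : OpenPartialHomeomorph M (Model m)) :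
    AEMeasurable e.symm ((volume : Measure (Model m)).restrict e.target) :=
  e.continuousOn_symm.aemeasurable e.open_target.measurableSet

theorem chartVolume_apply (g : SmoothMetric m M) (e : OpenPartialHomeomorph M (Model m))
    {A : Set M} (hA : MeasurableSet A) :
    chartVolume g e A = ∫⁻ y in e.target ∩ e.symm ⁻¹' A, ENNReal.ofReal (density g e y) := by
  rw [chartVolume, Measure.map_apply_of_aemeasurable
    ((aemeasurable_symm e).mono_ac (withDensity_absolutelyContinuous _ _)) hA, withDensity_apply',
    Measure.restrict_restrict' e.open_target.measurableSet, inter_comm]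
  rfl

/-- Change of variables: the factor `|det J|` is the ratio of the two densities by
`sqrt_det_metricMatrix`. The inequality suffices, since it is used for each ordered pair of charts.
-/
theorem chartVolume_restrict_le (he : e ∈ atlas (Model m) M) (he' : e' ∈ atlas (Model m) M) :
    (chartVolume g e).restrict e'.source ≤ chartVolume g e' := by
  refine Measure.le_iff.2 fun A hA ↦ ?_
  have hB := hA.inter e'.open_source.measurableSet
  rw [Measure.restrict_apply hA, chartVolume_apply g e hB, chartVolume_apply g e' hA]
  set N := e.target ∩ e.symm ⁻¹' (A ∩ e'.source) with hN
  have hNm : MeasurableSet N := measurableSet_target_inter_preimage e hB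
  have hd : ∀ y ∈ N, HasFDerivWithinAt (e' ∘ e.symm) (fderiv ℝ (e' ∘ e.symm) y) N y := by
    intro y hy
    have h := contDiffAt_transition he he' (e.map_target hy.1) hy.2.2
    rw [e.right_inv hy.1] at h
    exact (h.differentiableAt (by simp)).hasFDerivAt.hasFDerivWithinAt
  have hinj : InjOn (e' ∘ e.symm) N := fun y hy z hz hyz ↦
    e.symm.injOn hy.1 hz.1 (e'.injOn hy.2.2 hz.2.2 hyz)
  have h1 := lintegral_image_eq_lintegral_abs_det_fderiv_mul volume hNm hd hinj
    (fun y ↦ ENNReal.ofReal (density g e' y))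
  have h2 : ∫⁻ y in N, ENNReal.ofReal (density g e y)
      = ∫⁻ y in N, ENNReal.ofReal |(fderiv ℝ (e' ∘ e.symm) y).det|
        * ENNReal.ofReal (density g e' ((e' ∘ e.symm) y)) := by
    refine setLIntegral_congr_fun hNm fun y hy ↦ ?_
    have h := sqrt_det_metricMatrix g he he' (e.map_target hy.1) hy.2.2
    rw [jacobian_det, e.right_inv hy.1] at h
    simp only [density]
    rw [h, ENNReal.ofReal_mul (abs_nonneg _)]
    rfl
  rw [h2, ← h1]
  refine lintegral_mono_set ?_
  rintro _ ⟨y, hy, rfl⟩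
  refine ⟨e'.map_source hy.2.2, ?_⟩
  simp only [mem_preimage, Function.comp_apply, e'.left_inv hy.2.2]
  exact hy.2.1

theorem volumeMeasure_restrict (he : e ∈ atlas (Model m) M) :
    (volumeMeasure g).restrict e.source = chartVolume g e := by
  have hs := e.open_source.measurableSet
  refine le_antisymm ?_ ?_
  -- Each chart measure is bounded by `chartVolume g e` on `e.source`. Elsewhere no bound is needed,
  -- so `⊤` serves there and disappears on restriction.
  · have h1 : volumeMeasure g ≤ chartVolume g e + (⊤ : Measure M).restrict e.sourceᶜ := by
      refine iSup₂_le fun e' he' ↦ ?_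
      rw [← Measure.restrict_add_restrict_compl (μ := chartVolume g e') hs]
      exact add_le_add (chartVolume_restrict_le he' he) (Measure.restrict_mono le_rfl le_top)
    calc (volumeMeasure g).restrict e.source
        ≤ (chartVolume g e + (⊤ : Measure M).restrict e.sourceᶜ).restrict e.source :=
          Measure.restrict_mono le_rfl h1
      _ = (chartVolume g e).restrict e.source := by
          rw [Measure.restrict_add, Measure.restrict_restrict hs, inter_compl_self,
            Measure.restrict_empty, add_zero]
      _ ≤ chartVolume g e := Measure.restrict_le_self
  · have h1 : (chartVolume g e).restrict e.source = chartVolume g e := by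
      refine Measure.restrict_eq_self_of_ae_mem ?_
      rw [ae_iff]
      change chartVolume g e e.sourceᶜ = 0
      rw [chartVolume_apply g e hs.compl]
      convert setLIntegral_empty _
      ext y
      simp only [mem_inter_iff, mem_preimage, mem_compl_iff, mem_empty_iff_false, iff_false, not_and,
        not_not]
      exact e.map_target
    rw [← h1]
    exact Measure.restrict_mono le_rfl (le_iSup₂_of_le e he le_rfl)

theorem integrable_chartVolume_iff (hc : ContinuousOn (density g e) e.target) {F : M → ℝ}
    (hF : Measurable F) : Integrable F (chartVolume g e)
      ↔ IntegrableOn (fun y ↦ density g e y * F (e.symm y)) e.target := by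
  have hm := (aemeasurable_symm e).mono_ac
    (withDensity_absolutelyContinuous ((volume : Measure (Model m)).restrict e.target)
      fun y ↦ ENNReal.ofReal (density g e y))
  have hd : AEMeasurable (fun y ↦ ENNReal.ofReal (density g e y))
      ((volume : Measure (Model m)).restrict e.target) :=
    (hc.aemeasurable e.open_target.measurableSet).ennreal_ofReal
  refine (integrable_map_measure hF.aestronglyMeasurable hm).trans ?_
  rw [integrable_withDensity_iff_integrable_smul₀' hd (by simp)]
  simp only [ENNReal.toReal_ofReal (Real.sqrt_nonneg _), density, smul_eq_mul, Function.comp_apply,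
    IntegrableOn]

theorem integral_chartVolume (hc : ContinuousOn (density g e) e.target) {F : M → ℝ}
    (hF : Measurable F) :
    ∫ p, F p ∂(chartVolume g e) = ∫ y in e.target, density g e y * F (e.symm y) := by
  have hm := (aemeasurable_symm e).mono_ac
    (withDensity_absolutelyContinuous ((volume : Measure (Model m)).restrict e.target)
      fun y ↦ ENNReal.ofReal (density g e y))
  have hd : AEMeasurable (fun y ↦ ENNReal.ofReal (density g e y))
      ((volume : Measure (Model m)).restrict e.target) :=
    (hc.aemeasurable e.open_target.measurableSet).ennreal_ofReal
  refine (integral_map hm hF.aestronglyMeasurable).trans ?_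
  rw [integral_withDensity_eq_integral_toReal_smul₀ hd (by simp)]
  simp only [ENNReal.toReal_ofReal (Real.sqrt_nonneg _), density, smul_eq_mul]

end Volume

end Foliation

namespace CoordGeom

/-! ### Integration against compactly supported functions in coordinates. -/

section Cutoff

variable {E : Type*} [NormedAddCommGroup E] [NormedSpace ℝ E] {U : Set E} {r a : E → ℝ}
  {t₀ t : ℝ}

/-- The function `r` is smooth with compact support contained in `U`. -/
structure IsCutoff (U : Set E) (r : E → ℝ) : Prop where
  smooth : ContDiff ℝ ∞ r
  compact : HasCompactSupport r
  subset : tsupport r ⊆ U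

theorem IsCutoff.eq_zero (hr : IsCutoff U r) {y : E} (hy : y ∉ U) : r y = 0 :=
  image_eq_zero_of_notMem_tsupport fun h ↦ hy (hr.subset h)

theorem IsCutoff.fderiv_apply (hr : IsCutoff U r) (v : E) : IsCutoff U (fun y ↦ fderiv ℝ r y v) where
  smooth := (hr.smooth.fderiv_right (m := ∞) (by simp)).clm_apply contDiff_const
  compact := hr.compact.fderiv_apply ℝ v
  subset := (tsupport_fderiv_apply_subset ℝ v).trans hr.subset

theorem IsCutoff.continuous_mul (hr : IsCutoff U r) (hU : IsOpen U) (ha : ContinuousOn a U) :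
    Continuous fun y ↦ r y * a y := by
  rw [continuous_iff_continuousAt]
  intro y
  by_cases hy : y ∈ tsupport r
  · exact hr.smooth.continuous.continuousAt.mul (ha.continuousAt (hU.mem_nhds (hr.subset hy)))
  · refine (continuousAt_const (y := (0 : ℝ))).congr ?_
    filter_upwards [(isClosed_tsupport r).isOpen_compl.mem_nhds hy] with z hz
    rw [image_eq_zero_of_notMem_tsupport hz, zero_mul]

theorem IsCutoff.hasCompactSupport_mul (hr : IsCutoff U r) :
    HasCompactSupport fun y ↦ r y * a y :=
  hr.compact.mul_right

variable [MeasurableSpace E] [BorelSpace E] {μ : Measure E}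

theorem IsCutoff.integrable_mul [IsFiniteMeasureOnCompacts μ] (hr : IsCutoff U r) (hU : IsOpen U)
    (ha : ContinuousOn a U) : Integrable (fun y ↦ r y * a y) μ :=
  (hr.continuous_mul hU ha).integrable_of_hasCompactSupport hr.hasCompactSupport_mul

theorem IsCutoff.integral_mul_fderiv [FiniteDimensional ℝ E] [μ.IsAddHaarMeasure]
    (hr : IsCutoff U r) (hU : IsOpen U) (ha : ContDiffOn ℝ ∞ a U) (v : E) :
    ∫ y, r y * fderiv ℝ a y v ∂μ = -∫ y, fderiv ℝ r y v * a y ∂μ := by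
  refine integral_mul_fderiv_eq_neg_fderiv_mul_of_integrable ?_ ?_ ?_ ?_ ?_
  · exact (hr.fderiv_apply v).integrable_mul hU ha.continuousOn
  · exact hr.integrable_mul hU
      ((ha.fderiv_of_isOpen (m := 0) hU (by simp)).continuousOn.clm_apply continuousOn_const)
  · exact hr.integrable_mul hU ha.continuousOn
  · exact fun y _ ↦ hr.smooth.differentiable (by simp) y
  · exact fun y hy ↦ (ha.differentiableOn (by simp)).differentiableAt
      (hU.mem_nhds (hr.subset hy))

/-- Differentiation under the integral sign, one-sidedly at the end points. -/
theorem IsCutoff.hasDerivWithinAt_integral [IsFiniteMeasureOnCompacts μ] (hr : IsCutoff U r)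
    (hU : IsOpen U) (ht₀ : 0 < t₀) {a : E × ℝ → ℝ} (ha : ContDiffOn ℝ ∞ a (U ×ˢ Icc 0 t₀))
    (ht : t ∈ Icc 0 t₀) :
    HasDerivWithinAt (fun s ↦ ∫ y, r y * a (y, s) ∂μ)
      (∫ y, r y * pderiv (U ×ˢ Icc 0 t₀) (0, 1) a (y, t) ∂μ) (Icc 0 t₀) t := by
  have hda := ha.pderiv (uniqueDiffOn_slab hU ht₀) (0, 1)
  -- A bound for `∂_t a` on the compact set `tsupport r × [0, t₀]`; the mean value inequality then
  -- makes `|r| C` dominate the difference quotients.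
  obtain ⟨C, hC⟩ := (hr.compact.isCompact.prod isCompact_Icc).exists_bound_of_continuousOn
    (hda.continuousOn.mono (prod_mono hr.subset (Subset.refl (Icc 0 t₀))))
  have hderiv : ∀ y ∈ U, ∀ s ∈ Icc 0 t₀, HasDerivWithinAt (fun s ↦ a (y, s))
      (pderiv (U ×ˢ Icc 0 t₀) (0, 1) a (y, s)) (Icc 0 t₀) s := fun y hy s hs ↦
    hasDerivWithinAt_slab ha.differentiableOn_infty hy hs
  have hint : ∀ s ∈ Icc 0 t₀, Integrable (fun y ↦ r y * a (y, s)) μ := fun s hs ↦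
    hr.integrable_mul hU (continuousOn_slice ha.continuousOn hs)
  rw [hasDerivWithinAt_iff_tendsto_slope]
  have hslope : ∀ᶠ s in nhdsWithin t (Icc 0 t₀ \ {t}),
      ∫ y, r y * slope (fun s ↦ a (y, s)) t s ∂μ
        = slope (fun s ↦ ∫ y, r y * a (y, s) ∂μ) t s := by
    filter_upwards [self_mem_nhdsWithin] with s hs
    simp only [slope_def_field]
    rw [← integral_sub (hint s hs.1) (hint t ht), ← integral_div]
    congr 1 with y
    ring
  refine Filter.Tendsto.congr' hslope ?_
  refine tendsto_integral_filter_of_dominated_convergence (fun y ↦ |r y| * C) ?_ ?_ ?_ ?_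
  · filter_upwards [self_mem_nhdsWithin] with s hs
    refine (hr.continuous_mul hU ?_).aestronglyMeasurable
    simp only [slope_def_field]
    exact ((continuousOn_slice ha.continuousOn hs.1).sub
      (continuousOn_slice ha.continuousOn ht)).div_const _
  · filter_upwards [self_mem_nhdsWithin] with s hs
    refine Filter.Eventually.of_forall fun y ↦ ?_
    by_cases hy : y ∈ tsupport r
    · rw [norm_mul, Real.norm_eq_abs (r y)]
      refine mul_le_mul_of_nonneg_left ?_ (abs_nonneg _)
      have h := (convex_Icc 0 t₀).norm_image_sub_le_of_norm_hasDerivWithin_le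
        (fun x hx ↦ hderiv y (hr.subset hy) x hx) (fun x hx ↦ hC (y, x) ⟨hy, hx⟩) ht hs.1
      rw [slope_def_field, norm_div]
      exact (div_le_iff₀ (norm_pos_iff.2 (sub_ne_zero.2 hs.2))).2 h
    · simp [image_eq_zero_of_notMem_tsupport hy]
  · exact (hr.smooth.continuous.integrable_of_hasCompactSupport hr.compact).abs.mul_const C
  · refine Filter.Eventually.of_forall fun y ↦ ?_
    by_cases hy : y ∈ U
    · exact (hasDerivWithinAt_iff_tendsto_slope.1 (hderiv y hy t ht)).const_mul _
    · simp [hr.eq_zero hy, tendsto_const_nhds]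

end Cutoff

/-! ### The volume density and the divergence form of the Laplacian. -/

section Divergence

variable {V : Type*} [NormedAddCommGroup V] [NormedSpace ℝ V] {S : Set V}
  {ι : Type*} [Fintype ι] [DecidableEq ι] {z : V} {G : V → Matrix ι ι ℝ} {φ : V → ℝ}

theorem contDiffOn_sqrt_det (hG : IsMetricOn S G) : ContDiffOn ℝ ∞ (fun z ↦ √(G z).det) S :=
  hG.smooth.det.sqrt hG.det_ne

/-- Jacobi's formula applied to the square of `√det G`. For `v = ∂_t` this is `∂_t dσ = H dσ`; for
spatial `v` it enters the divergence form of the Laplacian. -/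
theorem pderiv_sqrt_det (hG : IsMetricOn S G) (hS : UniqueDiffOn ℝ S) (hz : z ∈ S) (v : V) :
    pderiv S v (fun z ↦ √(G z).det) z = leafH S v G z * √(G z).det := by
  have hs := (contDiffOn_sqrt_det hG).differentiableOn_infty
  have h1 := pderiv_det (v := v) hG.smooth hG.det_ne hS hz
  have h2 : pderiv S v (fun z ↦ (G z).det) z
      = pderiv S v (fun z ↦ √(G z).det * √(G z).det) z :=
    pderiv_congr (fun w hw ↦ (Real.mul_self_sqrt (hG.det_pos w hw).le).symm) hz
  rw [h2, pderiv_mul hS hz hs hs] at h1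
  have h3 : 0 < √(G z).det := Real.sqrt_pos.2 (hG.det_pos z hz)
  have h4 := Real.mul_self_sqrt (hG.det_pos z hz).le
  rw [leafH, shape]
  have h5 : (2 * √(G z).det) * pderiv S v (fun z ↦ √(G z).det) z
      = (2 * √(G z).det) * (1 / 2 * ((G z)⁻¹ * matDeriv S v G z).trace * √(G z).det) := by
    linear_combination h1 - ((G z)⁻¹ * matDeriv S v G z).trace * h4
  exact mul_left_cancel₀ (by positivity) h5

/-- This is `Γ^i_{ik} = ∂_k log √det G`; `leafH` in a coordinate direction is only a name for that
logarithmic derivative. Two of the three Christoffel terms cancel by symmetry of `G⁻¹`. -/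
theorem sum_christoffel_contract (hG : IsMetricOn S G) (hz : z ∈ S) (b : ι → V) (k : ι) :
    ∑ i, christoffel S b G i i k z = leafH S (b k) G z := by
  have h1 : ∑ i, ∑ l, (G z)⁻¹ i l * pderiv S (b i) (fun z ↦ G z k l) z
      = ∑ i, ∑ l, (G z)⁻¹ i l * pderiv S (b l) (fun z ↦ G z i k) z := by
    rw [Finset.sum_comm]
    refine Finset.sum_congr rfl fun i _ ↦ Finset.sum_congr rfl fun l _ ↦ ?_
    rw [hG.inv_symm hz, hG.matDeriv_symm hz _ k i]
  simp only [christoffel, leafH, ← Finset.mul_sum, mul_add, mul_sub, Finset.sum_add_distrib,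
    Finset.sum_sub_distrib, Matrix.trace, Matrix.diag, h1]
  simp only [sum_inv_mul_pderiv hG hz]
  ring

theorem contDiffOn_laplacian (hG : IsMetricOn S G) (hS : UniqueDiffOn ℝ S) (b : ι → V)
    (hφ : ContDiffOn ℝ ∞ φ S) : ContDiffOn ℝ ∞ (laplacian S b G φ) S :=
  ContDiffOn.sum fun i _ ↦ ((contDiffOn_grad hG hS b hφ i).pderiv hS _).add <|
    ContDiffOn.sum fun k _ ↦ (contDiffOn_christoffel hG hS b i i k).mul
      (contDiffOn_grad hG hS b hφ k)

/-- The Laplacian in divergence form. -/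
theorem laplacian_mul_sqrt_det (hG : IsMetricOn S G) (hS : UniqueDiffOn ℝ S) (hz : z ∈ S)
    (hφ : ContDiffOn ℝ ∞ φ S) (b : ι → V) :
    laplacian S b G φ z * √(G z).det
      = ∑ i, pderiv S (b i) (fun z ↦ grad S b G φ i z * √(G z).det) z := by
  have h1 : laplacian S b G φ z
      = ∑ i, (pderiv S (b i) (grad S b G φ i) z + leafH S (b i) G z * grad S b G φ i z) := by
    simp only [laplacian, Finset.sum_add_distrib]
    rw [Finset.sum_comm (f := fun i k ↦ christoffel S b G i i k z * grad S b G φ k z)]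
    simp only [← Finset.sum_mul, sum_christoffel_contract hG hz]
  rw [h1, Finset.sum_mul]
  refine Finset.sum_congr rfl fun i _ ↦ ?_
  rw [pderiv_mul hS hz (contDiffOn_grad hG hS b hφ i).differentiableOn_infty
    (contDiffOn_sqrt_det hG).differentiableOn_infty, pderiv_sqrt_det hG hS hz]
  ring

end Divergence

end CoordGeom

namespace Foliation

open CoordGeom

/-! ### Global functions from coordinate expressions. -/

section Glue

variable {m : ℕ} {M : Type*} [TopologicalSpace M] [ChartedSpace (Model m) M]
  [IsManifold 𝓘(ℝ, Model m) ∞ M] {e e' : OpenPartialHomeomorph M (Model m)} {p : M}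
  {t₀ t : ℝ} {g : ℝ → SmoothMetric m M} {f : M × ℝ → ℝ}
  {c c' : OpenPartialHomeomorph M (Model m) → Model m × ℝ → ℝ}

omit [IsManifold 𝓘(ℝ, Model m) ∞ M] in
/-- The expressions `c e` are the coordinate representations of one smooth function. -/
structure IsInvariant (t₀ : ℝ) (c : OpenPartialHomeomorph M (Model m) → Model m × ℝ → ℝ) :
    Prop where
  smooth : ∀ e ∈ atlas (Model m) M, ContDiffOn ℝ ∞ (c e) (slab t₀ e)
  eq : ∀ e ∈ atlas (Model m) M, ∀ e' ∈ atlas (Model m) M, ∀ p ∈ e.source, p ∈ e'.source →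
    ∀ t ∈ Icc 0 t₀, c e (e p, t) = c e' (e' p, t)

/-- The function on `M` with coordinate representations `c e` at time `t`. -/
def glue (c : OpenPartialHomeomorph M (Model m) → Model m × ℝ → ℝ) (t : ℝ) (p : M) : ℝ :=
  c (chartAt (Model m) p) (chartAt (Model m) p p, t)

omit [IsManifold 𝓘(ℝ, Model m) ∞ M] in
-- `glue` changes chart from point to point; invariance lets it be read in one fixed chart.
theorem IsInvariant.glue_eq (hc : IsInvariant t₀ c) (he : e ∈ atlas (Model m) M)
    (hp : p ∈ e.source) (ht : t ∈ Icc 0 t₀) : glue c t p = c e (e p, t) :=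
  hc.eq _ (chart_mem_atlas _ p) e he p (mem_chart_source _ p) hp t ht

omit [IsManifold 𝓘(ℝ, Model m) ∞ M] in
theorem IsInvariant.glue_symm (hc : IsInvariant t₀ c) (he : e ∈ atlas (Model m) M)
    {y : Model m} (hy : y ∈ e.target) (ht : t ∈ Icc 0 t₀) :
    glue c t (e.symm y) = c e (y, t) := by
  rw [hc.glue_eq he (e.map_target hy) ht, e.right_inv hy]

omit [IsManifold 𝓘(ℝ, Model m) ∞ M] in
theorem IsInvariant.continuous_glue (hc : IsInvariant t₀ c) (ht : t ∈ Icc 0 t₀) :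
    Continuous (glue c t : M → ℝ) := by
  rw [continuous_iff_continuousAt]
  intro p
  set e := chartAt (Model m) p with he_def
  have he : e ∈ atlas (Model m) M := chart_mem_atlas _ p
  have hp : p ∈ e.source := mem_chart_source _ p
  have h1 : ContinuousAt (fun y ↦ c e (y, t)) (e p) :=
    (continuousOn_slice (hc.smooth e he).continuousOn ht).continuousAt
      (e.open_target.mem_nhds (e.map_source hp))
  refine (ContinuousAt.comp (g := fun y ↦ c e (y, t)) h1 (e.continuousAt hp)).congr ?_
  filter_upwards [e.open_source.mem_nhds hp] with q hq
  exact (hc.glue_eq he hq ht).symm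

theorem isInvariant_slabH (ht₀ : 0 < t₀) (hg : SmoothFamily t₀ g) :
    IsInvariant t₀ (slabH t₀ g) where
  smooth _ he := contDiffOn_slabH ht₀ hg he
  eq _ he _ he' _ hp hp' _ ht := slabH_eq ht₀ hg he he' hp hp' ht

theorem isInvariant_slabSq (ht₀ : 0 < t₀) (hg : SmoothFamily t₀ g) :
    IsInvariant t₀ (slabSq t₀ g) where
  smooth _ he := contDiffOn_slabSq ht₀ hg he
  eq _ he _ he' _ hp hp' _ ht := slabSq_eq ht₀ hg he he' hp hp' ht

theorem contDiffOn_comp_symm {q : M → ℝ} (hq : ContMDiff 𝓘(ℝ, Model m) 𝓘(ℝ, ℝ) ∞ q)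
    (he : e ∈ atlas (Model m) M) : ContDiffOn ℝ ∞ (q ∘ e.symm) e.target := by
  rw [← contMDiffOn_iff_contDiffOn]
  exact hq.comp_contMDiffOn
    (contMDiffOn_symm_of_mem_maximalAtlas (IsManifold.subset_maximalAtlas he))

/-- The coordinate representations of the inner product of the gradients of `q` and `f`. -/
def slabPairing (t₀ : ℝ) (g : ℝ → SmoothMetric m M) (q : M → ℝ) (f : M × ℝ → ℝ)
    (e : OpenPartialHomeomorph M (Model m)) (z : Model m × ℝ) : ℝ :=
  ∑ k, fderiv ℝ (q ∘ e.symm) z.1 (frame m k)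
    * grad (slab t₀ e) (leafFrame m) (famMatrix g e) (inChart f e) k z

theorem slabPairing_chart {q : M → ℝ} (hf : SmoothOnSlab (m := m) t₀ f)
    (he : e ∈ atlas (Model m) M) (hp : p ∈ e.source) (ht : t ∈ Icc 0 t₀) :
    slabPairing t₀ g q f e (e p, t) = gradPairing (g t) e q (fun p ↦ f (p, t)) p := by
  have h : ∀ l, chartDeriv e (fun p ↦ f (p, t)) p l
      = pderiv (slab t₀ e) (leafFrame m l) (inChart f e) (e p, t) := fun l ↦
    fderiv_slab e.open_target (hf.inChart he).differentiableOn_infty (e.map_source hp) ht _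
  have h' : chartDeriv e (fun p ↦ f (p, t)) p
      = fun l ↦ pderiv (slab t₀ e) (leafFrame m l) (inChart f e) (e p, t) := funext h
  rw [gradPairing, h']
  rfl

theorem isInvariant_slabPairing {q : M → ℝ} (ht₀ : 0 < t₀) (hg : SmoothFamily t₀ g)
    (hf : SmoothOnSlab (m := m) t₀ f) (hq : ContMDiff 𝓘(ℝ, Model m) 𝓘(ℝ, ℝ) ∞ q) :
    IsInvariant t₀ (slabPairing t₀ g q f) where
  smooth e he := by
    refine ContDiffOn.sum fun k _ ↦ ContDiffOn.mul ?_
      (contDiffOn_grad (hg.isMetricOn he) (uniqueDiffOn_slab' ht₀ e) _ (hf.inChart he) k)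
    have h1 : ContDiffOn ℝ ∞ (fderiv ℝ (q ∘ e.symm)) e.target :=
      (contDiffOn_comp_symm hq he).fderiv_of_isOpen e.open_target (by simp)
    exact (h1.comp contDiff_fst.contDiffOn fun z hz ↦ hz.1).clm_apply contDiffOn_const
  eq e he e' he' p hp hp' t ht := by
    rw [slabPairing_chart hf he hp ht, slabPairing_chart hf he' hp' ht]
    refine gradPairing_eq (g t) he he' hp hp' ?_ ?_
    · exact ((contDiffOn_comp_symm hq he').differentiableOn (by simp)).differentiableAt
        (e'.open_target.mem_nhds (e'.map_source hp'))
    · exact (hasFDerivAt_slab e'.open_target (hf.inChart he').differentiableOn_infty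
        (e'.map_source hp') ht).differentiableAt

/-- The density of the Riemannian volume of the family in the chart `e`. -/
def slabDensity (g : ℝ → SmoothMetric m M) (e : OpenPartialHomeomorph M (Model m))
    (z : Model m × ℝ) : ℝ :=
  √(famMatrix g e z).det

theorem contDiffOn_slabDensity (hg : SmoothFamily t₀ g) (he : e ∈ atlas (Model m) M) :
    ContDiffOn ℝ ∞ (slabDensity g e) (slab t₀ e) :=
  contDiffOn_sqrt_det (hg.isMetricOn he)

theorem continuousOn_density (hg : SmoothFamily t₀ g) (he : e ∈ atlas (Model m) M)
    (ht : t ∈ Icc 0 t₀) : ContinuousOn (density (g t) e) e.target :=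
  continuousOn_slice (contDiffOn_slabDensity hg he).continuousOn ht

end Glue

/-! ### Integration over the leaves by a partition of unity. -/

section Integration

variable {m : ℕ} {M : Type*} [TopologicalSpace M] [T2Space M] [CompactSpace M]
  [ChartedSpace (Model m) M] [IsManifold 𝓘(ℝ, Model m) ∞ M]
  {e : OpenPartialHomeomorph M (Model m)} {p : M}
  {t₀ t : ℝ} {g : ℝ → SmoothMetric m M} {f : M × ℝ → ℝ}
  {c : OpenPartialHomeomorph M (Model m) → Model m × ℝ → ℝ} {q : M → ℝ}

/-- The function `q` in the coordinates of the chart `e`, extended by zero. -/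
def localRep (q : M → ℝ) (e : OpenPartialHomeomorph M (Model m)) : Model m → ℝ :=
  e.target.indicator (q ∘ e.symm)

omit [T2Space M] in
-- The support is contained in the compact image of `tsupport q` inside the open chart target, so
-- extension by zero is smooth.
theorem isCutoff_localRep (hq : ContMDiff 𝓘(ℝ, Model m) 𝓘(ℝ, ℝ) ∞ q)
    (he : e ∈ atlas (Model m) M) (hs : tsupport q ⊆ e.source) :
    IsCutoff e.target (localRep q e) := by
  have hK : IsCompact (e '' tsupport q) :=
    (isClosed_tsupport q).isCompact.image_of_continuousOn (e.continuousOn.mono hs)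
  have hKt : e '' tsupport q ⊆ e.target := by
    rintro _ ⟨p, hp, rfl⟩
    exact e.map_source (hs hp)
  have h0 : ∀ y ∉ e '' tsupport q, localRep q e y = 0 := by
    intro y hy
    by_cases hyt : y ∈ e.target
    · rw [localRep, indicator_of_mem hyt]
      exact image_eq_zero_of_notMem_tsupport (f := q) fun h ↦ hy ⟨_, h, e.right_inv hyt⟩
    · exact indicator_of_notMem hyt _
  have hsub : tsupport (localRep q e) ⊆ e '' tsupport q :=
    closure_minimal (fun y hy ↦ by_contra fun h ↦ hy (h0 y h)) hK.isClosed
  refine ⟨contDiff_iff_contDiffAt.2 fun y ↦ ?_, HasCompactSupport.intro hK h0, hsub.trans hKt⟩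
  by_cases hy : y ∈ e.target
  · refine (((contDiffOn_comp_symm hq he).contDiffAt (e.open_target.mem_nhds hy))).congr_of_eventuallyEq ?_
    filter_upwards [e.open_target.mem_nhds hy] with w hw
    exact indicator_of_mem hw _
  · refine (contDiffAt_const (c := (0 : ℝ))).congr_of_eventuallyEq ?_
    filter_upwards [hK.isClosed.isOpen_compl.mem_nhds fun h ↦ hy (hKt h)] with w hw
    exact h0 w hw

/-- A finite smooth partition of unity subordinate to the preferred charts. -/
theorem exists_partition (m : ℕ) (M : Type*) [TopologicalSpace M] [T2Space M] [CompactSpace M]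
    [ChartedSpace (Model m) M] [IsManifold 𝓘(ℝ, Model m) ∞ M] :
    ∃ (s : Finset M) (ρ : M → M → ℝ),
      (∀ i, ContMDiff 𝓘(ℝ, Model m) 𝓘(ℝ, ℝ) ∞ (ρ i)) ∧
      (∀ i, tsupport (ρ i) ⊆ (chartAt (Model m) i).source) ∧ ∀ p, ∑ i ∈ s, ρ i p = 1 := by
  obtain ⟨ρ, hρ⟩ := SmoothPartitionOfUnity.exists_isSubordinate_chartAt_source
    (I := 𝓘(ℝ, Model m)) (M := M)
  have hfin := ρ.locallyFinite.finite_nonempty_of_compact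
  refine ⟨hfin.toFinset, fun i ↦ ρ i, fun i ↦ (ρ i).contMDiff, hρ, fun p ↦ ?_⟩
  rw [← ρ.sum_eq_one (mem_univ p), finsum_eq_sum_of_support_subset]
  intro i hi
  rw [Finite.coe_toFinset]
  exact ⟨p, hi⟩

variable [MeasurableSpace M] [BorelSpace M]

omit [T2Space M] [CompactSpace M] in
theorem integral_volumeMeasure_of_support (hg : SmoothFamily t₀ g) (he : e ∈ atlas (Model m) M)
    (ht : t ∈ Icc 0 t₀) {F : M → ℝ} (hF : Measurable F) (h0 : ∀ p ∉ e.source, F p = 0) :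
    ∫ p, F p ∂(volumeMeasure (g t)) = ∫ y in e.target, slabDensity g e (y, t) * F (e.symm y) := by
  rw [← setIntegral_eq_integral_of_forall_compl_eq_zero h0, volumeMeasure_restrict he,
    integral_chartVolume (continuousOn_density hg he ht) hF]
  rfl

omit [T2Space M] [CompactSpace M] in
theorem integrable_volumeMeasure_of_support (hg : SmoothFamily t₀ g) (he : e ∈ atlas (Model m) M)
    (ht : t ∈ Icc 0 t₀) {F : M → ℝ} (hF : Measurable F) (h0 : ∀ p ∉ e.source, F p = 0) :
    Integrable F (volumeMeasure (g t))
      ↔ IntegrableOn (fun y ↦ slabDensity g e (y, t) * F (e.symm y)) e.target := by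
  rw [← integrableOn_iff_integrable_of_support_subset (s := e.source)
    fun p hp ↦ by_contra fun h ↦ hp (h0 p h), IntegrableOn, volumeMeasure_restrict he,
    integrable_chartVolume_iff (continuousOn_density hg he ht) hF]
  rfl

omit [T2Space M] [CompactSpace M] [MeasurableSpace M] [BorelSpace M] in
theorem localRep_mul_indicator (hc : IsInvariant t₀ c) (he : e ∈ atlas (Model m) M)
    (ht : t ∈ Icc 0 t₀) :
    (fun y ↦ localRep q e y * (c e (y, t) * slabDensity g e (y, t)))
      = e.target.indicator fun y ↦ slabDensity g e (y, t) * (q (e.symm y) * glue c t (e.symm y)) := by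
  ext y
  by_cases hy : y ∈ e.target
  · rw [indicator_of_mem hy, localRep, indicator_of_mem hy, hc.glue_symm he hy ht]
    simp only [Function.comp_apply]
    ring
  · rw [indicator_of_notMem hy, localRep, indicator_of_notMem hy, zero_mul]

omit [T2Space M] in
theorem integrable_mul_glue (hg : SmoothFamily t₀ g) (hc : IsInvariant t₀ c)
    (he : e ∈ atlas (Model m) M) (ht : t ∈ Icc 0 t₀)
    (hq : ContMDiff 𝓘(ℝ, Model m) 𝓘(ℝ, ℝ) ∞ q) (hs : tsupport q ⊆ e.source) :
    Integrable (fun p ↦ q p * glue c t p) (volumeMeasure (g t)) := by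
  have hm : Measurable fun p ↦ q p * glue c t p :=
    (hq.continuous.mul (hc.continuous_glue ht)).measurable
  rw [integrable_volumeMeasure_of_support hg he ht hm fun p hp ↦ by
      rw [image_eq_zero_of_notMem_tsupport fun h ↦ hp (hs h), zero_mul],
    ← integrable_indicator_iff e.open_target.measurableSet, ← localRep_mul_indicator hc he ht]
  exact (isCutoff_localRep hq he hs).integrable_mul e.open_target (continuousOn_slice
    ((hc.smooth e he).mul (contDiffOn_slabDensity hg he)).continuousOn ht)

omit [T2Space M] [CompactSpace M] in
theorem integral_mul_glue (hg : SmoothFamily t₀ g) (hc : IsInvariant t₀ c)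
    (he : e ∈ atlas (Model m) M) (ht : t ∈ Icc 0 t₀)
    (hq : ContMDiff 𝓘(ℝ, Model m) 𝓘(ℝ, ℝ) ∞ q) (hs : tsupport q ⊆ e.source) :
    ∫ p, q p * glue c t p ∂(volumeMeasure (g t))
      = ∫ y, localRep q e y * (c e (y, t) * slabDensity g e (y, t)) := by
  have hm : Measurable fun p ↦ q p * glue c t p :=
    (hq.continuous.mul (hc.continuous_glue ht)).measurable
  rw [integral_volumeMeasure_of_support hg he ht hm fun p hp ↦ by
      rw [image_eq_zero_of_notMem_tsupport fun h ↦ hp (hs h), zero_mul],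
    localRep_mul_indicator hc he ht, integral_indicator e.open_target.measurableSet]

variable {s : Finset M} {ρ : M → M → ℝ}

omit [T2Space M] in
theorem integrable_glue (hg : SmoothFamily t₀ g) (hc : IsInvariant t₀ c) (ht : t ∈ Icc 0 t₀)
    (hρ : ∀ i, ContMDiff 𝓘(ℝ, Model m) 𝓘(ℝ, ℝ) ∞ (ρ i))
    (hs : ∀ i, tsupport (ρ i) ⊆ (chartAt (Model m) i).source) (h1 : ∀ p, ∑ i ∈ s, ρ i p = 1) :
    Integrable (glue c t) (volumeMeasure (g t)) := by
  have h := integrable_finsetSum s fun i _ ↦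
    integrable_mul_glue hg hc (chart_mem_atlas (Model m) i) ht (hρ i) (hs i)
  simpa only [← Finset.sum_mul, h1, one_mul] using h

omit [T2Space M] in
theorem integral_glue (hg : SmoothFamily t₀ g) (hc : IsInvariant t₀ c) (ht : t ∈ Icc 0 t₀)
    (hρ : ∀ i, ContMDiff 𝓘(ℝ, Model m) 𝓘(ℝ, ℝ) ∞ (ρ i))
    (hs : ∀ i, tsupport (ρ i) ⊆ (chartAt (Model m) i).source) (h1 : ∀ p, ∑ i ∈ s, ρ i p = 1) :
    ∫ p, glue c t p ∂(volumeMeasure (g t))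
      = ∑ i ∈ s, ∫ y, localRep (ρ i) (chartAt (Model m) i) y
        * (c (chartAt (Model m) i) (y, t) * slabDensity g (chartAt (Model m) i) (y, t)) := by
  have h2 : ∀ p, glue c t p = ∑ i ∈ s, ρ i p * glue c t p := fun p ↦ by
    rw [← Finset.sum_mul, h1, one_mul]
  rw [integral_congr_ae (Filter.Eventually.of_forall h2), integral_finsetSum s fun i _ ↦
    integrable_mul_glue hg hc (chart_mem_atlas (Model m) i) ht (hρ i) (hs i)]
  exact Finset.sum_congr rfl fun i _ ↦
    integral_mul_glue hg hc (chart_mem_atlas (Model m) i) ht (hρ i) (hs i)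

omit [T2Space M] in
/-- The derivative of the integral of a function over the leaves. -/
theorem hasDerivWithinAt_integral_glue (ht₀ : 0 < t₀) (hg : SmoothFamily t₀ g)
    (hc : IsInvariant t₀ c) (ht : t ∈ Icc 0 t₀)
    (hρ : ∀ i, ContMDiff 𝓘(ℝ, Model m) 𝓘(ℝ, ℝ) ∞ (ρ i))
    (hs : ∀ i, tsupport (ρ i) ⊆ (chartAt (Model m) i).source) (h1 : ∀ p, ∑ i ∈ s, ρ i p = 1) :
    HasDerivWithinAt (fun s ↦ ∫ p, glue c s p ∂(volumeMeasure (g s)))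
      (∑ i ∈ s, ∫ y, localRep (ρ i) (chartAt (Model m) i) y
        * ((pderiv (slab t₀ (chartAt (Model m) i)) (0, 1) (c (chartAt (Model m) i)) (y, t)
            + c (chartAt (Model m) i) (y, t) * slabH t₀ g (chartAt (Model m) i) (y, t))
          * slabDensity g (chartAt (Model m) i) (y, t))) (Icc 0 t₀) t := by
  refine HasDerivWithinAt.congr (f := fun s' ↦ ∑ i ∈ s, ∫ y, localRep (ρ i) (chartAt (Model m) i) y
        * (c (chartAt (Model m) i) (y, s') * slabDensity g (chartAt (Model m) i) (y, s'))) ?_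
    (fun s' hs' ↦ integral_glue hg hc hs' hρ hs h1) (integral_glue hg hc ht hρ hs h1)
  refine HasDerivWithinAt.fun_sum fun i _ ↦ ?_
  have he := chart_mem_atlas (Model m) i
  have hcut := isCutoff_localRep (hρ i) he (hs i)
  have hS := uniqueDiffOn_slab' ht₀ (chartAt (Model m) i)
  refine (hcut.hasDerivWithinAt_integral (μ := volume) (chartAt (Model m) i).open_target ht₀
    ((hc.smooth _ he).mul (contDiffOn_slabDensity hg he)) ht).congr_deriv ?_
  refine integral_congr_ae (Filter.Eventually.of_forall fun y ↦ ?_)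
  beta_reduce
  by_cases hy : y ∈ (chartAt (Model m) i).target
  · have hz : (y, t) ∈ slab t₀ (chartAt (Model m) i) := ⟨hy, ht⟩
    have h2 := pderiv_mul (v := ((0 : Model m), (1 : ℝ))) hS hz
      (hc.smooth _ he).differentiableOn_infty (contDiffOn_slabDensity hg he).differentiableOn_infty
    have h3 : pderiv (slab t₀ (chartAt (Model m) i)) (0, 1)
        (slabDensity g (chartAt (Model m) i)) (y, t)
        = slabH t₀ g (chartAt (Model m) i) (y, t) * slabDensity g (chartAt (Model m) i) (y, t) :=
      pderiv_sqrt_det (hg.isMetricOn he) hS hz ((0 : Model m), (1 : ℝ))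
    rw [h3] at h2
    refine congrArg _ (h2.trans ?_)
    ring
  · rw [hcut.eq_zero hy, zero_mul, zero_mul]

omit [T2Space M] in
-- Integration by parts in the chart. The result is an integral over `M` of the chart-independent
-- pairing of `dq` and `df`, so the contributions of different charts can be added; invariance of
-- the Laplacian itself is not needed.
theorem integral_localRep_mul_laplacian (ht₀ : 0 < t₀) (hg : SmoothFamily t₀ g)
    (hf : SmoothOnSlab (m := m) t₀ f) (ht : t ∈ Icc 0 t₀) (he : e ∈ atlas (Model m) M)
    (hq : ContMDiff 𝓘(ℝ, Model m) 𝓘(ℝ, ℝ) ∞ q) (hs : tsupport q ⊆ e.source) :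
    ∫ y, localRep q e y
        * (laplacian (slab t₀ e) (leafFrame m) (famMatrix g e) (inChart f e) (y, t)
          * slabDensity g e (y, t))
      = -∫ p, glue (slabPairing t₀ g q f) t p ∂(volumeMeasure (g t)) := by
  have hP := isInvariant_slabPairing ht₀ hg hf hq
  have hcut := isCutoff_localRep hq he hs
  have hS := uniqueDiffOn_slab' ht₀ e
  have hG := hg.isMetricOn he
  have hf' := hf.inChart he
  have hA : ∀ k, ContDiffOn ℝ ∞ (fun z ↦ grad (slab t₀ e) (leafFrame m) (famMatrix g e)
      (inChart f e) k z * slabDensity g e z) (slab t₀ e) := fun k ↦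
    (contDiffOn_grad hG hS _ hf' k).mul (contDiffOn_slabDensity hg he)
  set A : Fin m → Model m → ℝ := fun k y ↦ grad (slab t₀ e) (leafFrame m) (famMatrix g e)
      (inChart f e) k (y, t) * slabDensity g e (y, t) with hA_def
  have hAt : ∀ k, ContDiffOn ℝ ∞ (A k) e.target := fun k ↦ contDiffOn_slice (hA k) ht
  have h1 : ∀ y, localRep q e y
        * (laplacian (slab t₀ e) (leafFrame m) (famMatrix g e) (inChart f e) (y, t)
          * slabDensity g e (y, t)) = ∑ k, localRep q e y * fderiv ℝ (A k) y (frame m k) := by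
    intro y
    by_cases hy : y ∈ e.target
    · rw [← Finset.mul_sum]
      refine congrArg _ ((laplacian_mul_sqrt_det hG hS ⟨hy, ht⟩ hf' (leafFrame m)).trans ?_)
      exact Finset.sum_congr rfl fun k _ ↦
        (fderiv_slab e.open_target (hA k).differentiableOn_infty hy ht _).symm
    · simp only [hcut.eq_zero hy, zero_mul, Finset.sum_const_zero]
  have h2 : ∀ y, ∑ k, fderiv ℝ (localRep q e) y (frame m k) * A k y
      = e.target.indicator
        (fun y ↦ slabDensity g e (y, t) * glue (slabPairing t₀ g q f) t (e.symm y)) y := by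
    intro y
    by_cases hy : y ∈ e.target
    · have h3 : localRep q e =ᶠ[nhds y] q ∘ e.symm := by
        filter_upwards [e.open_target.mem_nhds hy] with w hw
        exact indicator_of_mem hw _
      rw [indicator_of_mem hy, hP.glue_symm he hy ht, h3.fderiv_eq, slabPairing, Finset.mul_sum]
      refine Finset.sum_congr rfl fun k _ ↦ ?_
      simp only [hA_def]
      ring
    · rw [indicator_of_notMem hy]
      exact Finset.sum_eq_zero fun k _ ↦ by rw [(hcut.fderiv_apply (frame m k)).eq_zero hy, zero_mul]
  -- Outside `e.source` the function `q` vanishes locally, hence so does its derivative in any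
  -- chart, and the chart integral is the integral over all of `M`.
  have h0 : ∀ p ∉ e.source, glue (slabPairing t₀ g q f) t p = 0 := by
    intro p hp
    set e₀ := chartAt (Model m) p
    have hp₀ : p ∈ e₀.source := mem_chart_source _ p
    have h3 : q ∘ e₀.symm =ᶠ[nhds (e₀ p)] fun _ ↦ 0 := by
      have h4 : ∀ᶠ x in nhds p, q x = 0 := by
        filter_upwards [(isClosed_tsupport q).isOpen_compl.mem_nhds fun h ↦ hp (hs h)] with x hx
        exact image_eq_zero_of_notMem_tsupport hx
      have h5 := e₀.continuousAt_symm (e₀.map_source hp₀)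
      rw [ContinuousAt, e₀.left_inv hp₀] at h5
      exact h5.eventually h4
    rw [glue, slabPairing]
    refine Finset.sum_eq_zero fun k _ ↦ ?_
    rw [h3.fderiv_eq]
    simp
  rw [integral_congr_ae (Filter.Eventually.of_forall h1), integral_finsetSum _ fun k _ ↦
      hcut.integrable_mul e.open_target (((hAt k).fderiv_of_isOpen (m := 0) e.open_target
        (by simp)).continuousOn.clm_apply continuousOn_const),
    Finset.sum_congr rfl fun k _ ↦ hcut.integral_mul_fderiv e.open_target (hAt k) (frame m k),
    Finset.sum_neg_distrib, ← integral_finsetSum _ fun k _ ↦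
      (hcut.fderiv_apply (frame m k)).integrable_mul e.open_target (hAt k).continuousOn,
    integral_congr_ae (Filter.Eventually.of_forall h2),
    integral_indicator e.open_target.measurableSet,
    integral_volumeMeasure_of_support hg he ht (hP.continuous_glue ht).measurable h0]

omit [T2Space M] in
/-- The integral of the Laplacian vanishes. -/
theorem sum_integral_laplacian (ht₀ : 0 < t₀) (hg : SmoothFamily t₀ g)
    (hf : SmoothOnSlab (m := m) t₀ f) (ht : t ∈ Icc 0 t₀)
    (hρ : ∀ i, ContMDiff 𝓘(ℝ, Model m) 𝓘(ℝ, ℝ) ∞ (ρ i))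
    (hs : ∀ i, tsupport (ρ i) ⊆ (chartAt (Model m) i).source) (h1 : ∀ p, ∑ i ∈ s, ρ i p = 1) :
    ∑ i ∈ s, ∫ y, localRep (ρ i) (chartAt (Model m) i) y
      * (laplacian (slab t₀ (chartAt (Model m) i)) (leafFrame m)
          (famMatrix g (chartAt (Model m) i)) (inChart f (chartAt (Model m) i)) (y, t)
        * slabDensity g (chartAt (Model m) i) (y, t)) = 0 := by
  rw [Finset.sum_congr rfl fun i _ ↦ integral_localRep_mul_laplacian ht₀ hg hf ht
      (chart_mem_atlas (Model m) i) (hρ i) (hs i), Finset.sum_neg_distrib,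
    ← integral_finsetSum _ fun i _ ↦
      integrable_glue hg (isInvariant_slabPairing ht₀ hg hf (hρ i)) ht hρ hs h1, neg_eq_zero]
  -- At each `p` all pairings are read in the same chart and are linear in `dρ_i`, and `∑ dρ_i = d1
  -- = 0`.
  refine integral_eq_zero_of_ae (Filter.Eventually.of_forall fun p ↦ ?_)
  simp only [glue, slabPairing, Pi.zero_apply]
  rw [Finset.sum_comm]
  refine Finset.sum_eq_zero fun k _ ↦ ?_
  rw [← Finset.sum_mul]
  set e₀ := chartAt (Model m) p
  have hd : ∀ i ∈ s, DifferentiableAt ℝ (ρ i ∘ e₀.symm) (e₀ p) := fun i _ ↦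
    ((contDiffOn_comp_symm (hρ i) (chart_mem_atlas _ p)).differentiableOn
      (by simp)).differentiableAt (e₀.open_target.mem_nhds (mem_chart_target _ p))
  have h2 : ∑ i ∈ s, fderiv ℝ (ρ i ∘ e₀.symm) (e₀ p) = 0 := by
    rw [← fderiv_fun_sum hd]
    simp only [Function.comp_apply, h1]
    simp
  have h3 := congrArg (fun L : Model m →L[ℝ] ℝ ↦ L (frame m k)) h2
  rw [show ∑ i ∈ s, fderiv ℝ (ρ i ∘ e₀.symm) (e₀ p) (frame m k) = 0 by simpa using h3, zero_mul]

end Integration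

/-! ### First variation of the total mean curvature. -/

section Monotonicity

variable {m : ℕ} {M : Type*} [TopologicalSpace M] [T2Space M] [CompactSpace M]
  [ChartedSpace (Model m) M] [IsManifold 𝓘(ℝ, Model m) ∞ M]
  {t₀ t : ℝ} {g : ℝ → SmoothMetric m M} {f : M × ℝ → ℝ}
  {c c' : OpenPartialHomeomorph M (Model m) → Model m × ℝ → ℝ}

/-- The mean curvature of the leaves with respect to `g_f`, in the chart `e`. -/
def slabMean (t₀ : ℝ) (g : ℝ → SmoothMetric m M) (f : M × ℝ → ℝ)
    (e : OpenPartialHomeomorph M (Model m)) (z : Model m × ℝ) : ℝ :=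
  slabH t₀ g e z / inChart f e z

/-- The density of the derivative of the total mean curvature of the leaves with respect to a
scalar flat metric `g_f`, where the Ricci flat metric `g_η` is used to express the scalar
curvature of the leaves. -/
def slabRate (t₀ : ℝ) (g : ℝ → SmoothMetric m M) (η f : M × ℝ → ℝ)
    (e : OpenPartialHomeomorph M (Model m)) (z : Model m × ℝ) : ℝ :=
  inChart f e z * ((slabH t₀ g e z ^ 2 - slabSq t₀ g e z) / inChart η e z ^ 2) / 2
    + (slabH t₀ g e z ^ 2 - slabSq t₀ g e z) / (2 * inChart f e z)

omit [T2Space M] [CompactSpace M] in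
theorem isInvariant_slabMean (ht₀ : 0 < t₀) (hg : SmoothFamily t₀ g)
    (hf : SmoothOnSlab (m := m) t₀ f) (hpos : ∀ p : M, ∀ t ∈ Icc 0 t₀, 0 < f (p, t)) :
    IsInvariant t₀ (slabMean t₀ g f) where
  smooth e he := (contDiffOn_slabH ht₀ hg he).div (hf.inChart he) fun _ hz ↦ (hpos _ _ hz.2).ne'
  eq e he e' he' p hp hp' t ht := by
    simp only [slabMean, (isInvariant_slabH ht₀ hg).eq e he e' he' p hp hp' t ht,
      inChart, e.left_inv hp, e'.left_inv hp']

omit [T2Space M] [CompactSpace M] in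
theorem isInvariant_slabRate (ht₀ : 0 < t₀) (hg : SmoothFamily t₀ g) {η : M × ℝ → ℝ}
    (hη : SmoothOnSlab (m := m) t₀ η) (hη_pos : ∀ p : M, ∀ t ∈ Icc 0 t₀, 0 < η (p, t))
    (hf : SmoothOnSlab (m := m) t₀ f) (hpos : ∀ p : M, ∀ t ∈ Icc 0 t₀, 0 < f (p, t)) :
    IsInvariant t₀ (slabRate t₀ g η f) where
  smooth e he := by
    have h1 := ((contDiffOn_slabH ht₀ hg he).pow 2).sub (contDiffOn_slabSq ht₀ hg he)
    refine (((hf.inChart he).mul (h1.div ((hη.inChart he).pow 2) fun z hz ↦ ?_)).div_const 2).add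
      (h1.div (contDiffOn_const.mul (hf.inChart he)) fun z hz ↦ ?_)
    · exact pow_ne_zero 2 (hη_pos _ _ hz.2).ne'
    · exact mul_ne_zero two_ne_zero (hpos _ _ hz.2).ne'
  eq e he e' he' p hp hp' t ht := by
    simp only [slabRate, (isInvariant_slabH ht₀ hg).eq e he e' he' p hp hp' t ht,
      (isInvariant_slabSq ht₀ hg).eq e he e' he' p hp hp' t ht,
      inChart, e.left_inv hp, e'.left_inv hp']

variable [MeasurableSpace M] [BorelSpace M]

/-- The first variation of the total mean curvature of the leaves with respect to a scalar flat
metric `g_f`. -/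
theorem hasDerivWithinAt_integral_slabMean (ht₀ : 0 < t₀) (hg : SmoothFamily t₀ g) {η : M × ℝ → ℝ}
    (hη : SmoothOnSlab (m := m) t₀ η) (hη_pos : ∀ p : M, ∀ t ∈ Icc 0 t₀, 0 < η (p, t))
    (hRic : RicciFlat t₀ g η) (hf : SmoothOnSlab (m := m) t₀ f)
    (hpos : ∀ p : M, ∀ t ∈ Icc 0 t₀, 0 < f (p, t)) (hR : ScalarFlat t₀ g f) (ht : t ∈ Icc 0 t₀) :
    HasDerivWithinAt (fun s ↦ ∫ p, glue (slabMean t₀ g f) s p ∂(volumeMeasure (g s)))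
      (∫ p, glue (slabRate t₀ g η f) t p ∂(volumeMeasure (g t))) (Icc 0 t₀) t := by
  obtain ⟨s, ρ, hρ, hs, h1⟩ := exists_partition m M
  have hQ := isInvariant_slabRate ht₀ hg hη hη_pos hf hpos
  refine (hasDerivWithinAt_integral_glue ht₀ hg (isInvariant_slabMean ht₀ hg hf hpos) ht hρ hs
    h1).congr_deriv (Eq.symm ?_)
  -- The integrated Laplacian is zero; subtracting it makes the two integrands agree pointwise in
  -- each chart.
  rw [integral_glue hg hQ ht hρ hs h1, ← sub_zero (Finset.sum _ _),
    ← sum_integral_laplacian ht₀ hg hf ht hρ hs h1, ← Finset.sum_sub_distrib]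
  refine Finset.sum_congr rfl fun i _ ↦ ?_
  have he := chart_mem_atlas (Model m) i
  have hcut := isCutoff_localRep (hρ i) he (hs i)
  have hS := uniqueDiffOn_slab' ht₀ (chartAt (Model m) i)
  have hlap : ContDiffOn ℝ ∞ (laplacian (slab t₀ (chartAt (Model m) i)) (leafFrame m)
      (famMatrix g (chartAt (Model m) i)) (inChart f (chartAt (Model m) i)))
      (slab t₀ (chartAt (Model m) i)) :=
    contDiffOn_laplacian (hg.isMetricOn he) hS _ (hf.inChart he)
  have hw := contDiffOn_slabDensity hg he
  rw [← integral_sub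
    (hcut.integrable_mul (chartAt (Model m) i).open_target
      (continuousOn_slice ((hQ.smooth _ he).mul hw).continuousOn ht))
    (hcut.integrable_mul (chartAt (Model m) i).open_target
      (continuousOn_slice (hlap.mul hw).continuousOn ht))]
  refine integral_congr_ae (Filter.Eventually.of_forall fun y ↦ ?_)
  beta_reduce
  by_cases hy : y ∈ (chartAt (Model m) i).target
  · have hz : (y, t) ∈ slab t₀ (chartAt (Model m) i) := ⟨hy, ht⟩
    have h2 := hR.pderiv_meanCurvature ht₀ hg hf hpos he hz
    rw [hRic.leafScal_eq ht₀ hg hη hη_pos he hz] at h2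
    have h3 : pderiv (slab t₀ (chartAt (Model m) i)) (0, 1)
          (slabMean t₀ g f (chartAt (Model m) i)) (y, t)
        + slabMean t₀ g f (chartAt (Model m) i) (y, t) * slabH t₀ g (chartAt (Model m) i) (y, t)
        = slabRate t₀ g η f (chartAt (Model m) i) (y, t) - _ := h2
    rw [h3]
    ring
  · rw [hcut.eq_zero hy]
    ring

end Monotonicity

end Foliation

end

/-! ### Comparison of the two lapse functions. -/

theorem mainTheorem3 {m : ℕ} {M : Type*} [TopologicalSpace M] [T2Space M] [CompactSpace M]
    [ChartedSpace (Foliation.Model m) M] [IsManifold 𝓘(ℝ, Foliation.Model m) ∞ M]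
    [MeasurableSpace M] [BorelSpace M]
    (t₀ : ℝ) (ht₀ : 0 < t₀)
    (g : ℝ → Foliation.SmoothMetric m M) (hg : Foliation.SmoothFamily t₀ g)
    (hK : ∀ t ∈ Icc 0 t₀, ∀ p : M, 0 < Foliation.scalarCurvature (g t) p)
    (hH : ∀ t ∈ Icc 0 t₀, ∀ p : M, 0 < Foliation.meanCurvature t₀ g (fun _ ↦ 1) t p)
    (u η : M × ℝ → ℝ)
    (hu : Foliation.SmoothOnSlab (m := m) t₀ u) (hη : Foliation.SmoothOnSlab (m := m) t₀ η)
    (hu_pos : ∀ p : M, ∀ t ∈ Icc 0 t₀, 0 < u (p, t))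
    (hη_pos : ∀ p : M, ∀ t ∈ Icc 0 t₀, 0 < η (p, t))
    (hRu : Foliation.ScalarFlat t₀ g u) (hRicη : Foliation.RicciFlat t₀ g η) :
    (∀ t ∈ Icc 0 t₀,
      Integrable
        (fun p ↦ Foliation.meanCurvature t₀ g η t p - Foliation.meanCurvature t₀ g u t p)
        (Foliation.volumeMeasure (g t)) ∧
      Integrable
        (fun p ↦ Foliation.scalarCurvature (g t) p / 2 * (η (p, t) - u (p, t)) ^ 2 / u (p, t))
        (Foliation.volumeMeasure (g t)) ∧
      HasDerivWithinAt
        (fun s ↦ ∫ p, (Foliation.meanCurvature t₀ g η s p - Foliation.meanCurvature t₀ g u s p)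
          ∂(Foliation.volumeMeasure (g s)))
        (-∫ p, Foliation.scalarCurvature (g t) p / 2 * (η (p, t) - u (p, t)) ^ 2 / u (p, t)
          ∂(Foliation.volumeMeasure (g t)))
        (Icc 0 t₀) t) ∧
    AntitoneOn
      (fun t ↦ ∫ p, (Foliation.meanCurvature t₀ g η t p - Foliation.meanCurvature t₀ g u t p)
        ∂(Foliation.volumeMeasure (g t)))
      (Icc 0 t₀) := by
  open Foliation in
  obtain ⟨s, ρ, hρ, hs, h1⟩ := exists_partition m M
  have hmean : ∀ f : M × ℝ → ℝ, (∀ p : M, ∀ t ∈ Icc 0 t₀, 0 < f (p, t)) → ∀ t ∈ Icc 0 t₀, ∀ p,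
      meanCurvature t₀ g f t p = glue (slabMean t₀ g f) t p := fun f hf t ht p ↦ by
    rw [meanCurvature_eq hg ht (hf p t ht).ne', glue, slabMean, inChart,
      (chartAt (Model m) p).left_inv (mem_chart_source _ p)]
  -- With `H² - |h|² = 2 K η²` the rates are `K (u + η² / u)` and `2 K η`, and completing the square
  -- gives their difference.
  have hrate : ∀ t ∈ Icc 0 t₀, ∀ p,
      scalarCurvature (g t) p / 2 * (η (p, t) - u (p, t)) ^ 2 / u (p, t)
        = glue (slabRate t₀ g η u) t p - glue (slabRate t₀ g η η) t p := fun t ht p ↦ by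
    have he := chart_mem_atlas (Model m) p
    rw [scalarCurvature_eq ht₀ hg ht,
      hRicη.leafScal_eq ht₀ hg hη hη_pos he ⟨mem_chart_target _ p, ht⟩]
    simp only [glue, slabRate, inChart, (chartAt (Model m) p).left_inv (mem_chart_source _ p)]
    have h2 := (hη_pos p t ht).ne'
    have h3 := (hu_pos p t ht).ne'
    field_simp
    ring
  have hMη := isInvariant_slabMean ht₀ hg hη hη_pos
  have hMu := isInvariant_slabMean ht₀ hg hu hu_pos
  have hQη := isInvariant_slabRate ht₀ hg hη hη_pos hη hη_pos
  have hQu := isInvariant_slabRate ht₀ hg hη hη_pos hu hu_pos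
  have hint : ∀ {c : OpenPartialHomeomorph M (Model m) → Model m × ℝ → ℝ}, IsInvariant t₀ c →
      ∀ t ∈ Icc 0 t₀, Integrable (glue c t) (volumeMeasure (g t)) := fun hc t ht ↦
    integrable_glue hg hc ht hρ hs h1
  have hI : ∀ t ∈ Icc 0 t₀,
      ∫ p, (meanCurvature t₀ g η t p - meanCurvature t₀ g u t p) ∂(volumeMeasure (g t))
        = ∫ p, glue (slabMean t₀ g η) t p ∂(volumeMeasure (g t))
          - ∫ p, glue (slabMean t₀ g u) t p ∂(volumeMeasure (g t)) := fun t ht ↦ by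
    rw [← integral_sub (hint hMη t ht) (hint hMu t ht)]
    exact integral_congr_ae (Filter.Eventually.of_forall fun p ↦ by
      simp only [hmean η hη_pos t ht, hmean u hu_pos t ht])
  have hderiv : ∀ t ∈ Icc 0 t₀, HasDerivWithinAt
      (fun s ↦ ∫ p, (meanCurvature t₀ g η s p - meanCurvature t₀ g u s p) ∂(volumeMeasure (g s)))
      (-∫ p, scalarCurvature (g t) p / 2 * (η (p, t) - u (p, t)) ^ 2 / u (p, t)
        ∂(volumeMeasure (g t))) (Icc 0 t₀) t := fun t ht ↦ by
    have hη' := hasDerivWithinAt_integral_slabMean ht₀ hg hη hη_pos hRicη hη hη_pos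
      hRicη.scalarFlat ht
    have hu' := hasDerivWithinAt_integral_slabMean ht₀ hg hη hη_pos hRicη hu hu_pos hRu ht
    -- The rate for `η` is the same formula with `f = η`, which is available because a Ricci flat
    -- metric is scalar flat.
    rw [integral_congr_ae (Filter.Eventually.of_forall (hrate t ht)),
      integral_sub (hint hQu t ht) (hint hQη t ht), neg_sub]
    exact (hη'.sub hu').congr (fun s hs' ↦ hI s hs') (hI t ht)
  refine ⟨fun t ht ↦ ⟨?_, ?_, hderiv t ht⟩, ?_⟩
  · exact ((hint hMη t ht).sub (hint hMu t ht)).congr (Filter.Eventually.of_forall fun p ↦ by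
      simp only [hmean η hη_pos t ht, hmean u hu_pos t ht, Pi.sub_apply])
  · exact ((hint hQu t ht).sub (hint hQη t ht)).congr (Filter.Eventually.of_forall fun p ↦
      (hrate t ht p).symm)
  · refine antitoneOn_of_hasDerivWithinAt_nonpos (convex_Icc 0 t₀)
      (fun t ht ↦ (hderiv t ht).continuousWithinAt)
      (fun t ht ↦ (hderiv t (interior_subset ht)).mono interior_subset) fun t ht ↦ ?_
    rw [neg_nonpos]
    refine integral_nonneg fun p ↦ ?_
    have ht' := interior_subset ht
    exact div_nonneg (mul_nonneg (half_pos (hK t ht' p)).le (sq_nonneg _)) (hu_pos p t ht').le
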